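/- For a natural number $n\ge 1$ let $\widehat{\mathcal E}(n)\subset\mathbb R^3$ be the set of points $n^{-1/2}\mathbf x$, where $\mathbf x=(x_1,x_2,x_3)$ runs over the integral solutions of $x_1^2+x_2^2+x_3^2=n$, and, when $\widehat{\mathcal E}(n)$ has at least two points, let $$m(\widehat{\mathcal E}(n))=\min\{|P-Q| : P,Q\in\widehat{\mathcal E}(n),\ P\ne Q\},$$ where $|P-Q|$ is the Euclidean distance. Then for every $\varepsilon>0$ there is a constant $C=C(\varepsilon)>0$ such that, for almost all natural numbers $n$ with $4\nmid n$ and $n\not\equiv 7\pmod 8$, the set $\widehat{\mathcal E}(n)$ has at least two points and $$m(\widehat{\mathcal E}(n))\le C\,n^{-1/2}(\log n)^{1+\varepsilon}.$$ Here "for almost all" means that the number of $n$ with $1\le n\le X$, $4\nmid n$ and $n\not\equiv 7\pmod 8$ for which this fails is $o(X)$ as $X\to\infty$. -/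

import Mathlib

open Filter Topology

noncomputable section

/-- The set of normalised lattice points `n^{-1/2} x` in Euclidean 3-space, as `x` runs over all
integral solutions of `x₁² + x₂² + x₃² = n`. -/
def normalizedLatticePoints (n : ℕ) : Set (EuclideanSpace ℝ (Fin 3)) :=
  {P | ∃ x : Fin 3 → ℤ, x 0 ^ 2 + x 1 ^ 2 + x 2 ^ 2 = (n : ℤ) ∧
    P = ((n : ℝ) ^ (-1 / 2 : ℝ)) • WithLp.toLp 2 (fun i => (x i : ℝ))}

/-- The least Euclidean distance between two distinct points of `E`. For a finite set with at least
two points the infimum is a minimum; a set with at most one point has no minimal spacing, and then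
the value is `0` by convention (statements using it should require `E.Nontrivial`). -/
def minSpacing (E : Set (EuclideanSpace ℝ (Fin 3))) : ℝ := E.infsep

/-- `P n` holds for almost all natural numbers `n` with property `A`: the number of `1 ≤ n ≤ X`
having property `A` but failing `P` is `o(X)`. -/
def ForAlmostAll (A P : ℕ → Prop) : Prop :=
  Tendsto (fun X : ℕ => (({n : ℕ | 1 ≤ n ∧ n ≤ X ∧ A n ∧ ¬ P n}.ncard : ℕ) : ℝ) / (X : ℝ))
    atTop (𝓝 0)

end

/-! If `n = x² + y² + a²` with `a > 0`, the points `(x, y, a)` and `(x, y, -a)` are at distance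
`2a`. It therefore suffices that almost all admissible `n` have a representation with `0 < a ≤ (log
n)^(1+ε)`, and this is proved by a second moment argument.

Take a modulus `w` divisible by all small primes and an integer `k`, both fixed but large, and
consider `x = 1 + 2wξ`, `y = y₀ + 2wη`, `a = a₀ + 2wα` with `ξ` in `[k²Q, (k²+k)Q)`, `η` in `[Q,
2Q)` and `1 ≤ α ≤ A`, where `A` is about `(log Q)^(1+ε/2)`. The `N = kQ²A` sums of squares lie in
one class modulo `4w` and in an interval containing about `L = 2k³wQ²` members of that class. The
shape of the box matters: `x` varies by a factor close to `1`, so the values of `x²` have nearly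
constant density, while `y²` is small compared with the length of the interval.

By Cauchy–Schwarz the number of distinct values is at least `N²/M`, where `M` bounds the number of
pairs of points with equal values. If `M` is at most `(1 + small) N²/L = (1 + small) A²Q²/(2kw)`,
nearly the whole class is represented. This is `card_equalPairs_le`. Fixing `α, α'` leaves an
equation `x² + y² = x'² + y'² + 4wh`, whose solutions are counted (`card_collisions_le`) by fixing
`η' - η` and a gcd. The result is the expected size times the sum of `1/r` over divisors `r` of `h`
coprime to `w`. On average over `α, α'` that sum is close to `1`, because a divisor coprime to `w`
is `1` or large. The terms `α = α'` contribute about `AQ² log Q`, which is negligible against `A²Q²`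
once `A` exceeds `log Q` by a growing factor; this is the source of the exponent `1 + ε`.

Local solvability (`exists_modulus`) uses `4 ∤ n` and `n ≢ 7 mod 8`. Finally the classes are summed
over a block (`exists_block`) and the blocks over all `n ≤ X` (`exists_card_filter_range_le`). -/

/-! ### Elementary counting -/

/-- Integers that are pairwise congruent modulo `m` and at mutual distance at most `ℓ`. -/
lemma card_le_of_pairwise_dvd_sub (s : Finset ℤ) (m : ℤ) (hm : 0 < m) (ℓ : ℝ) (hℓ : 0 ≤ ℓ)
    (h1 : ∀ x ∈ s, ∀ y ∈ s, m ∣ x - y) (h2 : ∀ x ∈ s, ∀ y ∈ s, ((x - y : ℤ) : ℝ) ≤ ℓ) :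
    (s.card : ℝ) ≤ ℓ / m + 1 := by
  have hm' : (0 : ℝ) < m := by exact_mod_cast hm
  rcases s.eq_empty_or_nonempty with rfl | hs
  · simp only [Finset.card_empty, Nat.cast_zero]; positivity
  set x₀ := s.min' hs
  have hx₀ : x₀ ∈ s := s.min'_mem hs
  have key : s.card ≤ (Finset.range (⌊ℓ / m⌋₊ + 1)).card := by
    refine Finset.card_le_card_of_injOn (fun x => ((x - x₀) / m).toNat) ?_ ?_
    · intro x hx
      have hx : x ∈ s := hx
      obtain ⟨c, hc⟩ := h1 x hx x₀ hx₀
      have h3 := h2 x hx x₀ hx₀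
      have h4 : 0 ≤ x - x₀ := sub_nonneg.2 (s.min'_le x hx)
      simp only [Finset.coe_range, Set.mem_Iio]
      rw [hc, Int.mul_ediv_cancel_left _ hm.ne']
      have hc0 : 0 ≤ c := by
        by_contra hneg
        nlinarith
      rw [Nat.lt_succ_iff]
      refine Nat.le_floor ?_
      rw [le_div_iff₀ hm']
      have h5 : ((c.toNat : ℤ) : ℝ) = (c : ℝ) := by rw [Int.toNat_of_nonneg hc0]
      rw [Int.cast_natCast] at h5
      rw [h5, mul_comm]
      rw [hc] at h3
      exact_mod_cast h3
    · intro x hx y hy hxy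
      have hx : x ∈ s := hx
      have hy : y ∈ s := hy
      obtain ⟨c, hc⟩ := h1 x hx x₀ hx₀
      obtain ⟨e, he⟩ := h1 y hy x₀ hx₀
      have h4 : 0 ≤ x - x₀ := sub_nonneg.2 (s.min'_le x hx)
      have h4' : 0 ≤ y - x₀ := sub_nonneg.2 (s.min'_le y hy)
      simp only at hxy
      rw [hc, he, Int.mul_ediv_cancel_left _ hm.ne', Int.mul_ediv_cancel_left _ hm.ne'] at hxy
      have hc0 : 0 ≤ c := by
        by_contra hneg
        nlinarith
      have he0 : 0 ≤ e := by
        by_contra hneg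
        nlinarith
      have : c = e := by omega
      subst this
      omega
  rw [Finset.card_range] at key
  calc (s.card : ℝ) ≤ ((⌊ℓ / m⌋₊ + 1 : ℕ) : ℝ) := by exact_mod_cast key
    _ ≤ ℓ / m + 1 := by
      push_cast
      gcongr
      exact Nat.floor_le (by positivity)

lemma card_le_card_image_mul {α β : Type*} [DecidableEq β] (s : Finset α) (f : α → β) (B : ℝ)
    (hB : ∀ b ∈ s.image f, ((s.filter (fun a => f a = b)).card : ℝ) ≤ B) :
    (s.card : ℝ) ≤ (s.image f).card * B := by
  rw [Finset.card_eq_sum_card_image f s, Nat.cast_sum]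
  calc _ ≤ ∑ _b ∈ s.image f, B := Finset.sum_le_sum hB
    _ = _ := by rw [Finset.sum_const, nsmul_eq_mul]

/-! ### Collisions with prescribed differences -/

/-- Quadruples `(ξ, ξ', η, η')` with `η < η'`, in the box attached to `k` and `Q`, for which
`(1 + 2wξ)² + (y₀ + 2wη)²` exceeds `(1 + 2wξ')² + (y₀ + 2wη')²` by `4wh`. -/
noncomputable def collisions (w k Q : ℕ) (y₀ h : ℤ) : Finset (ℤ × ℤ × ℤ × ℤ) :=
  (Finset.Ico ((k ^ 2 * Q : ℕ) : ℤ) (((k ^ 2 + k) * Q : ℕ) : ℤ) ×ˢ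
    Finset.Ico ((k ^ 2 * Q : ℕ) : ℤ) (((k ^ 2 + k) * Q : ℕ) : ℤ) ×ˢ
    Finset.Ico (Q : ℤ) ((2 * Q : ℕ) : ℤ) ×ˢ Finset.Ico (Q : ℤ) ((2 * Q : ℕ) : ℤ)).filter
  (fun p => p.2.2.1 < p.2.2.2 ∧
    (p.1 - p.2.1) * (1 + w * (p.1 + p.2.1)) =
      (p.2.2.2 - p.2.2.1) * (y₀ + w * (p.2.2.1 + p.2.2.2)) + h)

lemma mem_collisions {w k Q : ℕ} {y₀ h x x' y y' : ℤ} :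
    (x, x', y, y') ∈ collisions w k Q y₀ h ↔
      (((k ^ 2 * Q : ℤ) ≤ x ∧ x < (k ^ 2 + k) * Q) ∧ ((k ^ 2 * Q : ℤ) ≤ x' ∧ x' < (k ^ 2 + k) * Q) ∧
        ((Q : ℤ) ≤ y ∧ y < 2 * Q) ∧ ((Q : ℤ) ≤ y' ∧ y' < 2 * Q)) ∧
      y < y' ∧ (x - x') * (1 + w * (x + x')) = (y' - y) * (y₀ + w * (y + y')) + h := by
  simp only [collisions, Finset.mem_filter, Finset.mem_product, Finset.mem_Ico]
  push_cast
  rfl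

/-- The collisions with prescribed differences. -/
lemma card_collisions_fiber (w k Q : ℕ) (hw : 0 < w) (y₀ h d u : ℤ) (hu : 0 < u) :
    (((collisions w k Q y₀ h).filter
      (fun p => p.2.2.2 - p.2.2.1 = u ∧ p.1 - p.2.1 = d)).card : ℝ) ≤
        k * Q * (Int.gcd d u) / u + 1 := by
  set s := (collisions w k Q y₀ h).filter (fun p => p.2.2.2 - p.2.2.1 = u ∧ p.1 - p.2.1 = d)
  have hwz : (0 : ℤ) < w := by exact_mod_cast hw
  have hg : 0 < Int.gcd d u := Int.gcd_pos_of_ne_zero_right _ hu.ne'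
  obtain ⟨d₁, u₁, hcop, hd, hu'⟩ := Int.exists_gcd_one hg
  set g := Int.gcd d u
  have hgz : (0 : ℤ) < g := by exact_mod_cast hg
  have hu₁ : 0 < u₁ := by
    by_contra hneg
    nlinarith
  -- Once both differences are fixed, the quadratic relation becomes linear in `ξ'` and `η`, so
  -- subtracting two instances removes `h` and the constants. Hence `ξ'` determines `η` and is fixed
  -- modulo `u / gcd(d, u)`.
  have hlin : ∀ p ∈ s, ∀ q ∈ s, d * (p.2.1 - q.2.1) = u * (p.2.2.1 - q.2.2.1) := by
    rintro ⟨x, x', y, y'⟩ hp ⟨z, z', t, t'⟩ hq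
    obtain ⟨hp, hp1, hp2⟩ := Finset.mem_filter.1 hp
    obtain ⟨hq, hq1, hq2⟩ := Finset.mem_filter.1 hq
    obtain ⟨-, -, e1⟩ := mem_collisions.1 hp
    obtain ⟨-, -, e2⟩ := mem_collisions.1 hq
    simp only at hp1 hp2 hq1 hq2 ⊢
    rw [hp1, hp2] at e1
    rw [hq1, hq2] at e2
    have f1 : x = d + x' := by omega
    have f2 : y' = u + y := by omega
    have f3 : z = d + z' := by omega
    have f4 : t' = u + t := by omega
    subst f1 f2 f3 f4
    have h2w : (2 * w : ℤ) ≠ 0 := by positivity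
    apply mul_left_cancel₀ h2w
    linear_combination e1 - e2
  have hinj : Set.InjOn (fun p : ℤ × ℤ × ℤ × ℤ => p.2.1) s := by
    rintro ⟨x, x', y, y'⟩ hp ⟨z, z', t, t'⟩ hq hpq
    have e := hlin _ hp _ hq
    obtain ⟨-, hp1, hp2⟩ := Finset.mem_filter.1 hp
    obtain ⟨-, hq1, hq2⟩ := Finset.mem_filter.1 hq
    simp only at hpq hp1 hp2 hq1 hq2 e
    subst hpq
    have : y - t = 0 := by
      have : u * (y - t) = 0 := by rw [← e]; ring
      exact (mul_eq_zero.1 this).resolve_left hu.ne'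
    ext <;> simp only <;> omega
  rw [← Finset.card_image_of_injOn hinj]
  have := card_le_of_pairwise_dvd_sub (s.image (fun p : ℤ × ℤ × ℤ × ℤ => p.2.1)) u₁ hu₁
    (k * Q) (by positivity) ?_ ?_
  · refine this.trans (le_of_eq ?_)
    have h1 : (u : ℝ) = u₁ * g := by exact_mod_cast hu'
    have h2 : (0 : ℝ) < g := by exact_mod_cast hg
    have h3 : (0 : ℝ) < u₁ := by exact_mod_cast hu₁
    rw [h1]
    field_simp
  · intro x' hx' z' hz'
    obtain ⟨p, hp, rfl⟩ := Finset.mem_image.1 hx'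
    obtain ⟨q, hq, rfl⟩ := Finset.mem_image.1 hz'
    have e := hlin _ hp _ hq
    rw [hd, hu'] at e
    have e' : d₁ * (p.2.1 - q.2.1) = u₁ * (p.2.2.1 - q.2.2.1) := by
      apply mul_left_cancel₀ hgz.ne'
      linear_combination e
    have hc : IsCoprime u₁ d₁ := (Int.isCoprime_iff_gcd_eq_one.2 hcop).symm
    exact hc.dvd_of_dvd_mul_left (Dvd.intro _ e'.symm)
  · intro x' hx' z' hz'
    obtain ⟨⟨x, x', y, y'⟩, hp, rfl⟩ := Finset.mem_image.1 hx'
    obtain ⟨⟨z, z', t, t'⟩, hq, rfl⟩ := Finset.mem_image.1 hz'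
    obtain ⟨⟨-, hp, -⟩, -⟩ := mem_collisions.1 (Finset.mem_filter.1 hp).1
    obtain ⟨⟨-, hq, -⟩, -⟩ := mem_collisions.1 (Finset.mem_filter.1 hq).1
    simp only
    have : x' - z' ≤ k * Q := by linarith [hp.2, hq.1]
    exact_mod_cast this

/-! ### Collisions with a prescribed difference of the second coordinates -/

/-- An upper bound for the spread of `ξ - ξ'` among the collisions with `η' - η = u`. -/
noncomputable def spread (k Q : ℕ) (u : ℝ) : ℝ := u / k ^ 2 * (1 - u / Q + 2 / k) + 1

/-- The difference `ξ - ξ'` is the quotient of `u(y₀ + w(η+η')) + h` by `1 + w(ξ+ξ')`. For fixed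
`u`, the sum `η + η'` ranges over an interval of length about `2(Q - u)`, which gives `1 - u/Q`. The
denominator varies by a factor `1 + 1/k`, which gives `2/k`, and `h` together with rounding costs at
most `1`. -/
lemma sub_le_spread {w k Q : ℕ} (hw : 0 < w) (hk : 0 < k) (hQ : 0 < Q) {y₀ h u : ℤ}
    (hy₀ : 0 ≤ y₀) (hy₀' : y₀ < 2 * w) (hh : |h| ≤ Q) {p q : ℤ × ℤ × ℤ × ℤ}
    (hp : p ∈ collisions w k Q y₀ h) (hq : q ∈ collisions w k Q y₀ h)
    (hpu : p.2.2.2 - p.2.2.1 = u) (hqu : q.2.2.2 - q.2.2.1 = u) :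
    (((p.1 - p.2.1) - (q.1 - q.2.1) : ℤ) : ℝ) ≤ spread k Q u := by
  obtain ⟨x, x', y, y'⟩ := p
  obtain ⟨z, z', t, t'⟩ := q
  simp only at hpu hqu ⊢
  obtain ⟨⟨⟨a1, a2⟩, ⟨a3, a4⟩, ⟨a5, a6⟩, a7, a8⟩, a9, ep⟩ := mem_collisions.1 hp
  obtain ⟨⟨⟨b1, b2⟩, ⟨b3, b4⟩, ⟨b5, b6⟩, b7, b8⟩, b9, eq⟩ := mem_collisions.1 hq
  rw [hpu] at ep
  rw [hqu] at eq
  set d := x - x'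
  set e := z - z'
  have hwz : (0 : ℤ) < w := by exact_mod_cast hw
  have hkz : (0 : ℤ) < k := by exact_mod_cast hk
  have hQz : (0 : ℤ) < Q := by exact_mod_cast hQ
  have hu : 0 < u := by omega
  have hh1 := (abs_le.1 hh).1
  have hh2 := (abs_le.1 hh).2
  -- As `η' = η + u ≤ 2Q - 1`, the sum `η + η'` is at most `4Q - u - 2`; the `2` absorbs `y₀ < 2w`.
  have V1 : y₀ + w * (y + y') ≤ w * (4 * Q - u) := by
    have : (w : ℤ) * (y + y') ≤ w * (4 * Q - u - 2) :=
      mul_le_mul_of_nonneg_left (by omega) hwz.le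
    linarith
  have V2 : w * (2 * Q + u) ≤ y₀ + w * (t + t') := by
    have : (w : ℤ) * (2 * Q + u) ≤ w * (t + t') := mul_le_mul_of_nonneg_left (by omega) hwz.le
    linarith
  have V3 : w * (2 * Q + u) ≤ y₀ + w * (y + y') := by
    have : (w : ℤ) * (2 * Q + u) ≤ w * (y + y') := mul_le_mul_of_nonneg_left (by omega) hwz.le
    linarith
  have E1 : 2 * w * k ^ 2 * Q ≤ 1 + w * (x + x') := by
    have : (w : ℤ) * (k ^ 2 * Q + k ^ 2 * Q) ≤ w * (x + x') :=
      mul_le_mul_of_nonneg_left (by linarith) hwz.le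
    linarith
  have E2 : 1 + w * (z + z') ≤ 2 * w * (k ^ 2 + k) * Q := by
    have : (w : ℤ) * (z + z') ≤ w * ((k ^ 2 + k) * Q + (k ^ 2 + k) * Q - 1) :=
      mul_le_mul_of_nonneg_left (by linarith) hwz.le
    linarith
  have E3 : 2 * w * k ^ 2 * Q ≤ 1 + w * (z + z') := by
    have : (w : ℤ) * (k ^ 2 * Q + k ^ 2 * Q) ≤ w * (z + z') :=
      mul_le_mul_of_nonneg_left (by linarith) hwz.le
    linarith
  have E0 : (0 : ℤ) < 2 * w * k ^ 2 * Q := by positivity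
  have VQ : (Q : ℤ) < w * (2 * Q + u) := by
    have : (1 : ℤ) * (2 * Q + u) ≤ w * (2 * Q + u) :=
      mul_le_mul_of_nonneg_right (by omega) (by omega)
    linarith
  have hpos : ∀ v : ℤ, w * (2 * Q + u) ≤ v → 0 < u * v + h := by
    intro v hv
    have : 1 * v ≤ u * v := mul_le_mul_of_nonneg_right (by omega) (by linarith)
    linarith
  have hd : 0 < d := pos_of_mul_pos_left (ep ▸ hpos _ V3) (E0.le.trans E1)
  have he : 0 < e := pos_of_mul_pos_left (eq ▸ hpos _ V2) (E0.le.trans E3)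
  have D1 : d * (2 * w * k ^ 2 * Q) ≤ u * (w * (4 * Q - u)) + Q := by
    have h1 := mul_le_mul_of_nonneg_left E1 hd.le
    have h2 := mul_le_mul_of_nonneg_left V1 hu.le
    linarith
  have D2 : u * (w * (2 * Q + u)) - Q ≤ e * (2 * w * (k ^ 2 + k) * Q) := by
    have h1 := mul_le_mul_of_nonneg_left E2 he.le
    have h2 := mul_le_mul_of_nonneg_left V2 hu.le
    linarith
  have huQ : u ≤ Q := by omega
  have D1' : (d : ℝ) * (2 * w * k ^ 2 * Q) ≤ u * (w * (4 * Q - u)) + Q := by exact_mod_cast D1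
  have D2' : (u : ℝ) * (w * (2 * Q + u)) - Q ≤ e * (2 * w * (k ^ 2 + k) * Q) := by
    exact_mod_cast D2
  have hwr : (1 : ℝ) ≤ w := by exact_mod_cast hw
  have hkr : (1 : ℝ) ≤ k := by exact_mod_cast hk
  have hQr : (1 : ℝ) ≤ Q := by exact_mod_cast hQ
  have hur : (0 : ℝ) < u := by exact_mod_cast hu
  have huQr : (u : ℝ) ≤ Q := by exact_mod_cast huQ
  have D3 : (d : ℝ) ≤ (u * (w * (4 * Q - u)) + Q) / (2 * w * k ^ 2 * Q) := by
    rw [le_div_iff₀ (by positivity)]; exact D1'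
  have D4 : (u * (w * (2 * Q + u)) - Q) / (2 * w * (k ^ 2 + k) * Q) ≤ (e : ℝ) := by
    rw [div_le_iff₀ (by positivity)]; exact D2'
  have D5 : (u * (w * (4 * Q - u)) + Q) / (2 * w * k ^ 2 * Q) =
      u / k ^ 2 * (2 - u / (2 * Q)) + 1 / (2 * w * k ^ 2 : ℝ) := by
    field_simp; ring
  have D6 : (u * (w * (2 * Q + u)) - Q) / (2 * w * (k ^ 2 + k) * Q) =
      u / k ^ 2 * (1 + u / (2 * Q)) - u / k ^ 2 * ((1 + u / (2 * Q)) / (k + 1))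
        - 1 / (2 * w * (k ^ 2 + k) : ℝ) := by
    have : (k : ℝ) + 1 ≠ 0 := by positivity
    have : (k : ℝ) ^ 2 + k = k * (k + 1) := by ring
    rw [this]
    field_simp; ring
  have D7 : 1 / (2 * w * k ^ 2 : ℝ) ≤ 1 / 2 := by
    apply one_div_le_one_div_of_le (by norm_num)
    nlinarith [one_le_pow₀ hkr (n := 2)]
  have D8 : 1 / (2 * w * (k ^ 2 + k) : ℝ) ≤ 1 / 2 := by
    apply one_div_le_one_div_of_le (by norm_num)
    nlinarith [one_le_pow₀ hkr (n := 2)]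
  have D9 : (1 + u / (2 * Q)) / (k + 1) ≤ (2 / k : ℝ) := by
    have : (u : ℝ) / (2 * Q) ≤ 1 := by
      rw [div_le_one (by positivity)]; linarith
    gcongr <;> linarith
  have D10 : (u : ℝ) / k ^ 2 * ((1 + u / (2 * Q)) / (k + 1)) ≤ u / k ^ 2 * (2 / k : ℝ) := by
    gcongr
  have D11 : (u : ℝ) / Q = u / (2 * Q) + u / (2 * Q) := by field_simp; ring
  rw [spread, D11]
  push_cast
  rw [D5] at D3
  rw [D6] at D4
  linarith

lemma spread_nonneg {k Q : ℕ} {u : ℝ} (hQ : 0 < Q) (hu : 0 ≤ u) (huQ : u ≤ Q) :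
    0 ≤ spread k Q u := by
  have hQr : (0 : ℝ) < Q := by exact_mod_cast hQ
  have : u / Q ≤ 1 := (div_le_one hQr).2 huQ
  have h2 : (0 : ℝ) ≤ 1 - u / Q + 2 / k := by
    have : (0 : ℝ) ≤ 2 / k := by positivity
    linarith
  unfold spread
  positivity

/-- Since `w` is even, `1 + wt` is odd, so the additional factor `2` does no harm. This is what
fixes `ξ - ξ'` modulo `2wg` rather than `wg`. -/
lemma isCoprime_one_add_mul {w : ℕ} (hw : 2 ∣ w) (t : ℤ) :
    IsCoprime (2 * w : ℤ) (1 + w * t) := by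
  have h1 : IsCoprime (w : ℤ) (1 + w * t) := ⟨-t, 1, by ring⟩
  have h2 : IsCoprime (2 : ℤ) (1 + w * t) :=
    h1.of_isCoprime_of_dvd_left (by exact_mod_cast hw)
  exact h2.mul_left h1

/-- The first factor counts the values of `ξ - ξ'`, which lie in one class modulo `2wg` and in an
interval of length `spread`; the second counts the collisions for each value. In the product of the
two leading terms `g` cancels. -/
lemma card_collisions_fiber_gcd {w k Q : ℕ} (hw : 0 < w) (hw2 : 2 ∣ w) (hk : 0 < k) (hQ : 0 < Q)
    {y₀ h u : ℤ} (hy₀ : 0 ≤ y₀) (hy₀' : y₀ < 2 * w) (hh : |h| ≤ Q) (hu : 0 < u) (huQ : u ≤ Q)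
    {g : ℕ} (hg : 0 < g) :
    (((collisions w k Q y₀ h).filter
      (fun p => p.2.2.2 - p.2.2.1 = u ∧ Int.gcd (p.1 - p.2.1) u = g)).card : ℝ) ≤
        (spread k Q u / (2 * w * g) + 1) * (k * Q * g / u + 1) := by
  set s := (collisions w k Q y₀ h).filter
      (fun p => p.2.2.2 - p.2.2.1 = u ∧ Int.gcd (p.1 - p.2.1) u = g)
  have hur : (0 : ℝ) < u := by exact_mod_cast hu
  have huQr : (u : ℝ) ≤ Q := by exact_mod_cast huQ
  have hgz : (0 : ℤ) < g := by exact_mod_cast hg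
  have hwz : (0 : ℤ) < w := by exact_mod_cast hw
  have h1 := card_le_card_image_mul s (fun p => p.1 - p.2.1) (k * Q * g / u + 1) ?_
  · refine h1.trans ?_
    gcongr
    have h2 := card_le_of_pairwise_dvd_sub (s.image (fun p => p.1 - p.2.1)) (2 * w * g)
      (by positivity) (spread k Q u) (spread_nonneg hQ hur.le huQr) ?_ ?_
    · exact_mod_cast h2
    · intro d hd e he
      obtain ⟨⟨x, x', y, y'⟩, hp, rfl⟩ := Finset.mem_image.1 hd
      obtain ⟨⟨z, z', t, t'⟩, hq, rfl⟩ := Finset.mem_image.1 he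
      obtain ⟨hp, hp1, hp2⟩ := Finset.mem_filter.1 hp
      obtain ⟨hq, hq1, hq2⟩ := Finset.mem_filter.1 hq
      obtain ⟨-, -, e1⟩ := mem_collisions.1 hp
      obtain ⟨-, -, e2⟩ := mem_collisions.1 hq
      simp only at hp1 hp2 hq1 hq2 ⊢
      have g1 : (g : ℤ) ∣ x - x' := hp2 ▸ Int.gcd_dvd_left _ _
      have g2 : (g : ℤ) ∣ z - z' := hq2 ▸ Int.gcd_dvd_left _ _
      have g3 : (g : ℤ) ∣ u := hp2 ▸ Int.gcd_dvd_right _ _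
      rw [hp1] at e1
      rw [hq1] at e2
      obtain ⟨a, ha⟩ := g1
      obtain ⟨b, hb⟩ := g2
      obtain ⟨c, hc⟩ := g3
      have f1 : x = g * a + x' := by omega
      have f2 : y' = u + y := by omega
      have f3 : z = g * b + z' := by omega
      have f4 : t' = u + t := by omega
      -- Two relations subtracted and divided by `g`: modulo `2w` only the terms in `a` and `b`
      -- survive, and they factor. The first factor is a unit modulo `2w`, hence `2w ∣ a - b`.
      have e3 : (1 + w * (g * a + g * b)) * (a - b) = (2 * w) * (c * y - c * t - a * x' + b * z') := by
        apply mul_left_cancel₀ hgz.ne'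
        rw [f1, f2] at e1
        rw [f3, f4] at e2
        rw [hc] at e1 e2
        linear_combination e1 - e2
      have hcop := isCoprime_one_add_mul hw2 (g * a + g * b)
      obtain ⟨m, hm⟩ := hcop.dvd_of_dvd_mul_left (Dvd.intro _ e3.symm)
      refine ⟨m, ?_⟩
      rw [ha, hb]
      linear_combination (g : ℤ) * hm
    · intro d hd e he
      obtain ⟨p, hp, rfl⟩ := Finset.mem_image.1 hd
      obtain ⟨q, hq, rfl⟩ := Finset.mem_image.1 he
      obtain ⟨hp, hp1, hp2⟩ := Finset.mem_filter.1 hp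
      obtain ⟨hq, hq1, hq2⟩ := Finset.mem_filter.1 hq
      exact sub_le_spread hw hk hQ hy₀ hy₀' hh hp hq hp1 hq1
  · intro d hd
    obtain ⟨p, hp, rfl⟩ := Finset.mem_image.1 hd
    obtain ⟨-, hp1, hp2⟩ := Finset.mem_filter.1 hp
    refine le_trans ?_ ((card_collisions_fiber w k Q hw y₀ h (p.1 - p.2.1) u hu).trans
      (le_of_eq (by rw [hp2])))
    norm_cast
    apply Finset.card_le_card
    intro q hq
    obtain ⟨hq, hq2⟩ := Finset.mem_filter.1 hq
    obtain ⟨hq, hq3, -⟩ := Finset.mem_filter.1 hq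
    exact Finset.mem_filter.2 ⟨hq, hq3, hq2⟩

lemma gcd_dvd_of_mem_collisions {w k Q : ℕ} {y₀ h u : ℤ} {p : ℤ × ℤ × ℤ × ℤ}
    (hp : p ∈ collisions w k Q y₀ h) (hpu : p.2.2.2 - p.2.2.1 = u) :
    Int.gcd (p.1 - p.2.1) u ∣ Int.gcd u h := by
  obtain ⟨x, x', y, y'⟩ := p
  obtain ⟨-, -, e⟩ := mem_collisions.1 hp
  simp only at hpu ⊢
  rw [hpu] at e
  refine Int.dvd_gcd (Int.gcd_dvd_right _ _) ?_
  have : h = (x - x') * (1 + w * (x + x')) - u * (y₀ + w * (y + y')) := by linarith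
  rw [this]
  exact ((Int.gcd_dvd_left _ _).mul_right _).sub ((Int.gcd_dvd_right _ _).mul_right _)

/-- Suppose a prime `q` divides both `w` and the quotient. Dividing the relation by `gq` gives `q ∣
d₁(1 + w(ξ+ξ'))`, and the second factor is `1` modulo `q`. So `q` divides both `d₁` and `u₁`, which
are coprime. -/
lemma coprime_gcd_div_gcd {w k Q : ℕ} {y₀ h u : ℤ} (hu : 0 < u) {p : ℤ × ℤ × ℤ × ℤ}
    (hp : p ∈ collisions w k Q y₀ h) (hpu : p.2.2.2 - p.2.2.1 = u) :
    Nat.Coprime (Int.gcd u h / Int.gcd (p.1 - p.2.1) u) w := by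
  obtain ⟨m, hm⟩ := gcd_dvd_of_mem_collisions hp hpu
  obtain ⟨x, x', y, y'⟩ := p
  obtain ⟨-, -, e⟩ := mem_collisions.1 hp
  simp only at hpu hm ⊢
  rw [hpu] at e
  have hg : 0 < Int.gcd (x - x') u := Int.gcd_pos_of_ne_zero_right _ hu.ne'
  obtain ⟨d₁, u₁, hcop, hd, hu'⟩ := Int.exists_gcd_one hg
  set g := Int.gcd (x - x') u
  have hgz : (g : ℤ) ≠ 0 := by exact_mod_cast hg.ne'
  rw [hm, Nat.mul_div_cancel_left _ hg]
  refine Nat.coprime_of_dvd fun q hq hqm hqw => ?_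
  have h1 : (g * q : ℤ) ∣ u := by
    refine dvd_trans ?_ (Int.gcd_dvd_left u h)
    rw [hm]; push_cast
    exact mul_dvd_mul_left _ (by exact_mod_cast hqm)
  have h2 : (g * q : ℤ) ∣ h := by
    refine dvd_trans ?_ (Int.gcd_dvd_right u h)
    rw [hm]; push_cast
    exact mul_dvd_mul_left _ (by exact_mod_cast hqm)
  have h3 : (q : ℤ) ∣ u₁ := by
    rw [hu', mul_comm u₁] at h1
    exact (mul_dvd_mul_iff_left hgz).1 h1
  have h4 : (q : ℤ) ∣ d₁ * (1 + w * (x + x')) := by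
    have : (g * q : ℤ) ∣ g * (d₁ * (1 + w * (x + x'))) := by
      have h5 : (g : ℤ) * (d₁ * (1 + w * (x + x'))) = u * (y₀ + w * (y + y')) + h := by
        rw [← e, hd]; ring
      rw [h5]
      exact (h1.mul_right _).add h2
    exact (mul_dvd_mul_iff_left hgz).1 this
  have hqp : Prime (q : ℤ) := Nat.prime_iff_prime_int.1 hq
  rcases hqp.dvd_or_dvd h4 with h5 | h5
  · have := Int.dvd_gcd h5 h3
    rw [hcop] at this
    exact hq.one_lt.ne' (Nat.dvd_one.1 (by exact_mod_cast this))
  · have h6 : (q : ℤ) ∣ w * (x + x') := (Int.natCast_dvd_natCast.2 hqw).mul_right _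
    have h7 : (q : ℤ) ∣ 1 := (dvd_add_left h6).1 h5
    exact hqp.not_dvd_one h7

/-! ### Divisor sums and the collision count for nonzero shift -/

/-- The divisors of `m` that are coprime to `w`. -/
def coprimeDivisors (w m : ℕ) : Finset ℕ := m.divisors.filter (fun r => r.Coprime w)

/-- The sum of the reciprocals of the divisors of `m` that are coprime to `w`. -/
noncomputable def sumInvDivisors (w m : ℕ) : ℝ := ∑ r ∈ coprimeDivisors w m, (1 / r : ℝ)

lemma card_coprimeDivisors_le (w m : ℕ) : (coprimeDivisors w m).card ≤ m :=
  (Finset.card_filter_le _ _).trans (Nat.card_divisors_le_self m)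

lemma pos_of_mem_coprimeDivisors {w m r : ℕ} (hr : r ∈ coprimeDivisors w m) : 0 < r :=
  Nat.pos_of_mem_divisors (Finset.mem_filter.1 hr).1

lemma sumInvDivisors_le (w m : ℕ) : sumInvDivisors w m ≤ m := by
  calc sumInvDivisors w m ≤ ∑ r ∈ coprimeDivisors w m, (1 : ℝ) := by
        refine Finset.sum_le_sum fun r hr => ?_
        have : (1 : ℝ) ≤ r := by exact_mod_cast pos_of_mem_coprimeDivisors hr
        exact (div_le_one (by linarith)).2 this
    _ ≤ m := by
        simp only [Finset.sum_const, nsmul_eq_mul, mul_one]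
        exact_mod_cast card_coprimeDivisors_le w m

/-- The possible gcds `g` are indexed by `r = gcd(u, h) / g`, a common divisor of `u` and `h`
coprime to `w`. The leading term is independent of `g`, so each `r` gets the same bound. -/
lemma card_collisions_row {w k Q : ℕ} (hw : 0 < w) (hw2 : 2 ∣ w) (hk : 0 < k) (hQ : 0 < Q)
    {y₀ h : ℤ} {u : ℕ} (hy₀ : 0 ≤ y₀) (hy₀' : y₀ < 2 * w) (hh : |h| ≤ Q) (hh0 : h ≠ 0)
    (hu : 0 < u) (huQ : u ≤ Q) :
    (((collisions w k Q y₀ h).filter (fun p => p.2.2.2 - p.2.2.1 = (u : ℤ))).card : ℝ) ≤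
      ((coprimeDivisors w h.natAbs).filter (fun r => r ∣ u)).card *
        (k * Q * spread k Q u / (2 * w * u) + spread k Q u / (2 * w) +
          k * Q * h.natAbs / u + 1) := by
  set K := Int.gcd u h with hK
  have hKpos : 0 < K := Int.gcd_pos_of_ne_zero_right _ hh0
  have huz : (0 : ℤ) < u := by exact_mod_cast hu
  have hur : (0 : ℝ) < u := by exact_mod_cast hu
  have hwr : (0 : ℝ) < w := by exact_mod_cast hw
  have hs0 : 0 ≤ spread k Q u := spread_nonneg hQ hur.le (by exact_mod_cast huQ)
  rw [Finset.card_eq_sum_card_fiberwise (f := fun p => K / Int.gcd (p.1 - p.2.1) u)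
    (t := (coprimeDivisors w h.natAbs).filter (fun r => r ∣ u)), Nat.cast_sum]
  · rw [← nsmul_eq_mul]
    refine Finset.sum_le_card_nsmul _ _ _ fun r hr => ?_
    have hrpos : 0 < r := pos_of_mem_coprimeDivisors (Finset.mem_filter.1 hr).1
    by_cases hrK : r ∣ K
    · have hg : 0 < K / r := Nat.div_pos (Nat.le_of_dvd hKpos hrK) hrpos
      have h1 := card_collisions_fiber_gcd hw hw2 hk hQ hy₀ hy₀' hh huz (by exact_mod_cast huQ) hg
      set g := K / r with hgdef
      have hgr : (1 : ℝ) ≤ g := by exact_mod_cast hg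
      have hgh : g ≤ h.natAbs := by
        refine Nat.le_of_dvd (Int.natAbs_pos.2 hh0) ((Nat.div_dvd_of_dvd hrK).trans ?_)
        exact Int.natCast_dvd.1 (Int.gcd_dvd_right _ _)
      have hghr : (g : ℝ) ≤ h.natAbs := by exact_mod_cast hgh
      have hsub : (((collisions w k Q y₀ h).filter (fun p => p.2.2.2 - p.2.2.1 = (u : ℤ))).filter
          (fun p => K / Int.gcd (p.1 - p.2.1) u = r)).card ≤ ((collisions w k Q y₀ h).filter
          (fun p => p.2.2.2 - p.2.2.1 = (u : ℤ) ∧ Int.gcd (p.1 - p.2.1) u = g)).card := by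
        apply Finset.card_le_card
        intro p hp
        obtain ⟨hp, hp1⟩ := Finset.mem_filter.1 hp
        obtain ⟨hp, hp2⟩ := Finset.mem_filter.1 hp
        refine Finset.mem_filter.2 ⟨hp, hp2, ?_⟩
        rw [hgdef, ← hp1, Nat.div_div_self (gcd_dvd_of_mem_collisions hp hp2) hKpos.ne']
      refine (Nat.cast_le.2 hsub).trans (h1.trans ?_)
      simp only [Int.cast_natCast]
      have e : (spread k Q u / (2 * w * g) + 1) * (k * Q * g / u + 1) =
          k * Q * spread k Q u / (2 * w * u) + spread k Q u / (2 * w) / g +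
          k * Q * g / u + 1 := by
        field_simp
        ring
      rw [e]
      have h2 : spread k Q u / (2 * w) / g ≤ spread k Q u / (2 * w) :=
        div_le_self (by positivity) hgr
      have h3 : (k * Q * g / u : ℝ) ≤ k * Q * h.natAbs / u := by gcongr
      linarith
    · have : (((collisions w k Q y₀ h).filter (fun p => p.2.2.2 - p.2.2.1 = (u : ℤ))).filter
          (fun p => K / Int.gcd (p.1 - p.2.1) u = r)).card = 0 := by
        rw [Finset.card_eq_zero, Finset.filter_eq_empty_iff]
        intro p hp hp1
        obtain ⟨hp, hp2⟩ := Finset.mem_filter.1 hp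
        exact hrK (hp1 ▸ Nat.div_dvd_of_dvd (gcd_dvd_of_mem_collisions hp hp2))
      rw [this, Nat.cast_zero]
      positivity
  · intro p hp
    obtain ⟨hp, hp2⟩ := Finset.mem_filter.1 (Finset.mem_coe.1 hp)
    have hd : K / Int.gcd (p.1 - p.2.1) u ∣ K :=
      Nat.div_dvd_of_dvd (gcd_dvd_of_mem_collisions hp hp2)
    refine Finset.mem_coe.2 (Finset.mem_filter.2 ⟨Finset.mem_filter.2 ⟨?_, ?_⟩, ?_⟩)
    · exact Nat.mem_divisors.2 ⟨hd.trans (Int.natCast_dvd.1 (Int.gcd_dvd_right _ _)),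
        Int.natAbs_ne_zero.2 hh0⟩
    · exact coprime_gcd_div_gcd huz hp hp2
    · exact hd.trans (Int.natCast_dvd_natCast.1 (Int.gcd_dvd_left _ _))

lemma sum_card_filter_dvd_mul (D : Finset ℕ) (Q : ℕ) (f : ℕ → ℝ) :
    ∑ u ∈ Finset.Icc 1 Q, ((D.filter (fun r => r ∣ u)).card : ℝ) * f u =
      ∑ r ∈ D, ∑ u ∈ (Finset.Icc 1 Q).filter (fun u => r ∣ u), f u := by
  simp_rw [Finset.card_filter, Nat.cast_sum, Finset.sum_mul]
  rw [Finset.sum_comm]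
  refine Finset.sum_congr rfl fun r _ => ?_
  rw [Finset.sum_filter]
  refine Finset.sum_congr rfl fun u _ => ?_
  split_ifs <;> simp

lemma filter_dvd_Icc {r Q : ℕ} (hr : 0 < r) :
    (Finset.Icc 1 Q).filter (fun u => r ∣ u) = (Finset.Icc 1 (Q / r)).image (fun j => r * j) := by
  ext u
  simp only [Finset.mem_filter, Finset.mem_Icc, Finset.mem_image]
  constructor
  · rintro ⟨⟨h1, h2⟩, j, rfl⟩
    exact ⟨j, ⟨Nat.pos_of_mul_pos_left h1, (Nat.le_div_iff_mul_le hr).2 (by linarith)⟩, rfl⟩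
  · rintro ⟨j, ⟨h1, h2⟩, rfl⟩
    have := (Nat.le_div_iff_mul_le hr).1 h2
    exact ⟨⟨Nat.mul_pos hr h1, by linarith⟩, dvd_mul_right _ _⟩

lemma sum_filter_dvd {r : ℕ} (hr : 0 < r) (Q : ℕ) (f : ℕ → ℝ) :
    ∑ u ∈ (Finset.Icc 1 Q).filter (fun u => r ∣ u), f u = ∑ j ∈ Finset.Icc 1 (Q / r), f (r * j) := by
  rw [filter_dvd_Icc hr, Finset.sum_image]
  intro a _ b _ hab
  exact Nat.eq_of_mul_eq_mul_left hr hab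

lemma sum_filter_dvd_one_sub_le {r Q : ℕ} (hr : 0 < r) (hQ : 0 < Q) :
    ∑ u ∈ (Finset.Icc 1 Q).filter (fun u => r ∣ u), (1 - u / Q : ℝ) ≤ Q / (2 * r) := by
  rw [sum_filter_dvd hr]
  have key : ∀ J : ℕ, ∑ j ∈ Finset.Icc 1 J, (1 - ((r * j : ℕ) : ℝ) / Q) =
      J - J * (J + 1) * r / (2 * Q) := by
    intro J
    have hQr : (Q : ℝ) ≠ 0 := by positivity
    induction J with
    | zero => simp
    | succ n ih =>
      rw [Finset.sum_Icc_succ_top (by omega), ih]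
      push_cast
      field_simp
      ring
  rw [key]
  have hrr : (0 : ℝ) < r := by exact_mod_cast hr
  have hQr : (0 : ℝ) < Q := by exact_mod_cast hQ
  set J : ℝ := ((Q / r : ℕ) : ℝ)
  have hJ : 0 ≤ J := Nat.cast_nonneg _
  rw [← sub_nonneg]
  -- The defect is an explicit nonnegative expression, so no rounding estimate for `⌊Q/r⌋` is
  -- needed.
  have : Q / (2 * r) - (J - J * (J + 1) * r / (2 * Q)) =
      ((Q - J * r) ^ 2 + J * r ^ 2) / (2 * r * Q) := by
    field_simp
    ring
  rw [this]
  positivity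

lemma sum_filter_dvd_one_le {r Q : ℕ} (hr : 0 < r) :
    ∑ _u ∈ (Finset.Icc 1 Q).filter (fun u => r ∣ u), (1 : ℝ) ≤ Q / r := by
  rw [sum_filter_dvd hr]
  simp only [Finset.sum_const, Nat.card_Icc, nsmul_eq_mul, mul_one, Nat.add_sub_cancel]
  exact Nat.cast_div_le

lemma sum_Icc_one_div_le (Q : ℕ) : ∑ u ∈ Finset.Icc 1 Q, (1 / u : ℝ) ≤ 1 + Real.log Q := by
  have := harmonic_le_one_add_log Q
  rw [harmonic_eq_sum_Icc] at this
  push_cast at this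
  simpa [one_div] using this

/-- Sum the row bounds over `u` and exchange with the sum over `r`. On multiples of `r` the weight
`1 - u/Q` has total at most `Q/(2r)`, which turns `Q/(2kw)` into the main constant `Q²/(4kw)`. The
relative error `10/k` collects the `2/k` of `spread` and the boundary term `spread/(2w)`. -/
lemma card_collisions_le {w k Q : ℕ} (hw : 0 < w) (hw2 : 2 ∣ w) (hk : 0 < k) (hQ : 0 < Q)
    {y₀ h : ℤ} (hy₀ : 0 ≤ y₀) (hy₀' : y₀ < 2 * w) (hh : |h| ≤ Q) (hh0 : h ≠ 0) :
    ((collisions w k Q y₀ h).card : ℝ) ≤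
      Q ^ 2 / (4 * k * w) * (1 + 10 / k) * sumInvDivisors w h.natAbs +
        3 * k * Q * (h.natAbs + 1) ^ 2 * (1 + Real.log Q) := by
  have hkr : (1 : ℝ) ≤ k := by exact_mod_cast hk
  have hQr : (1 : ℝ) ≤ Q := by exact_mod_cast hQ
  have hwr : (1 : ℝ) ≤ w := by exact_mod_cast hw
  have hlog : 0 ≤ Real.log Q := Real.log_nonneg hQr
  set D := coprimeDivisors w h.natAbs
  set H : ℝ := (h.natAbs : ℝ)
  have hH : 0 ≤ H := Nat.cast_nonneg _
  set ρ : ℕ → ℝ := fun u => ((D.filter (fun r => r ∣ u)).card : ℝ)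
  have hρ : ∀ u, ρ u ≤ H := fun u =>
    Nat.cast_le.2 ((Finset.card_filter_le _ _).trans (card_coprimeDivisors_le w h.natAbs))
  have hρ0 : ∀ u, 0 ≤ ρ u := fun u => Nat.cast_nonneg _
  have h1 : ((collisions w k Q y₀ h).card : ℝ) ≤ ∑ u ∈ Finset.Icc 1 Q, ρ u *
      (k * Q * spread k Q u / (2 * w * u) + spread k Q u / (2 * w) + k * Q * H / u + 1) := by
    rw [Finset.card_eq_sum_card_fiberwise (f := fun p => (p.2.2.2 - p.2.2.1).toNat)
      (t := Finset.Icc 1 Q), Nat.cast_sum]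
    · refine Finset.sum_le_sum fun u hu => ?_
      obtain ⟨hu1, hu2⟩ := Finset.mem_Icc.1 hu
      refine le_trans (Nat.cast_le.2 (Finset.card_le_card ?_))
        (card_collisions_row hw hw2 hk hQ hy₀ hy₀' hh hh0 hu1 hu2)
      intro p hp
      obtain ⟨hp, hp1⟩ := Finset.mem_filter.1 hp
      exact Finset.mem_filter.2 ⟨hp, by omega⟩
    · rintro ⟨x, x', y, y'⟩ hp
      obtain ⟨⟨-, -, ⟨a5, a6⟩, a7, a8⟩, a9, -⟩ := mem_collisions.1 (Finset.mem_coe.1 hp)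
      simp only [Finset.coe_Icc, Set.mem_Icc]
      omega
  have h2 : ∀ u ∈ Finset.Icc 1 Q, ρ u *
      (k * Q * spread k Q u / (2 * w * u) + spread k Q u / (2 * w) + k * Q * H / u + 1) ≤
      Q / (2 * k * w) * (ρ u * (1 - u / Q)) + (5 * Q / (2 * k ^ 2 * w) + 2) * (ρ u * 1) +
        k * Q * (H + 1) * H * (1 / u) := by
    intro u hu
    obtain ⟨hu1, hu2⟩ := Finset.mem_Icc.1 hu
    have hur : (1 : ℝ) ≤ u := by exact_mod_cast hu1
    have huQ : (u : ℝ) ≤ Q := by exact_mod_cast hu2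
    have e1 : k * Q * spread k Q u / (2 * w * u) =
        Q / (2 * k * w) * (1 - u / Q) + Q / (k ^ 2 * w) + k * Q / (2 * w * u) := by
      unfold spread
      field_simp
    have e2 : spread k Q u / (2 * w) ≤ 3 * Q / (2 * k ^ 2 * w) + 1 := by
      have a1 : (1 - u / Q + 2 / k : ℝ) ≤ 3 := by
        have : (0 : ℝ) ≤ u / Q := by positivity
        have : (2 : ℝ) / k ≤ 2 := div_le_self (by norm_num) hkr
        linarith
      have a2 : spread k Q u ≤ Q / k ^ 2 * 3 + 1 := by
        unfold spread
        have a3 : (u / k ^ 2 : ℝ) ≤ Q / k ^ 2 := by gcongr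
        have a4 := mul_le_mul_of_nonneg_left a1 (by positivity : (0 : ℝ) ≤ u / k ^ 2)
        linarith
      calc spread k Q u / (2 * w) ≤ (Q / k ^ 2 * 3 + 1) / (2 * w) := by gcongr
        _ = 3 * Q / (2 * k ^ 2 * w) + 1 / (2 * w) := by field_simp
        _ ≤ _ := by
          gcongr
          exact (div_le_one (by positivity)).2 (by linarith)
    have e3 : (k * Q / (2 * w * u) : ℝ) ≤ k * Q * (1 / u) := by
      rw [mul_one_div]
      gcongr
      nlinarith
    have e4 : ρ u * (k * Q * (H + 1) * (1 / u)) ≤ H * (k * Q * (H + 1) * (1 / u)) := by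
      gcongr
      exact hρ u
    have e5 : k * Q * spread k Q u / (2 * w * u) + spread k Q u / (2 * w) + k * Q * H / u + 1 ≤
        Q / (2 * k * w) * (1 - u / Q) + (5 * Q / (2 * k ^ 2 * w) + 2) +
          k * Q * (H + 1) * (1 / u) := by
      rw [e1]
      have : (5 * Q / (2 * k ^ 2 * w) : ℝ) = Q / (k ^ 2 * w) + 3 * Q / (2 * k ^ 2 * w) := by
        field_simp; ring
      rw [this]
      have : (k * Q * H / u : ℝ) = k * Q * H * (1 / u) := by ring
      rw [this]
      linarith
    have e6 := mul_le_mul_of_nonneg_left e5 (hρ0 u)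
    linarith
  refine (h1.trans (Finset.sum_le_sum h2)).trans ?_
  rw [Finset.sum_add_distrib, Finset.sum_add_distrib, ← Finset.mul_sum, ← Finset.mul_sum,
    ← Finset.mul_sum]
  have s1 : ∑ u ∈ Finset.Icc 1 Q, ρ u * (1 - u / Q : ℝ) ≤ Q / 2 * sumInvDivisors w h.natAbs := by
    rw [sum_card_filter_dvd_mul D Q (fun u => (1 - u / Q : ℝ)), sumInvDivisors, Finset.mul_sum]
    refine Finset.sum_le_sum fun r hr => ?_
    refine (sum_filter_dvd_one_sub_le (pos_of_mem_coprimeDivisors hr) hQ).trans (le_of_eq ?_)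
    ring
  have s2 : ∑ u ∈ Finset.Icc 1 Q, ρ u * (1 : ℝ) ≤ Q * sumInvDivisors w h.natAbs := by
    rw [sum_card_filter_dvd_mul D Q (fun u => (1 : ℝ)), sumInvDivisors, Finset.mul_sum]
    refine Finset.sum_le_sum fun r hr => ?_
    refine (sum_filter_dvd_one_le (pos_of_mem_coprimeDivisors hr)).trans (le_of_eq ?_)
    ring
  have s3 := sum_Icc_one_div_le Q
  have hσ := sumInvDivisors_le w h.natAbs
  have t1 := mul_le_mul_of_nonneg_left s1 (by positivity : (0 : ℝ) ≤ Q / (2 * k * w))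
  have t2 := mul_le_mul_of_nonneg_left s2 (by positivity : (0 : ℝ) ≤ 5 * Q / (2 * k ^ 2 * w) + 2)
  have t3 := mul_le_mul_of_nonneg_left s3 (by positivity : (0 : ℝ) ≤ k * Q * (H + 1) * H)
  set σ := sumInvDivisors w h.natAbs
  have e : Q ^ 2 / (4 * k * w) * (1 + 10 / k) * σ =
      Q / (2 * k * w) * (Q / 2 * σ) + 5 * Q / (2 * k ^ 2 * w) * (Q * σ) := by
    field_simp
    ring
  rw [e]
  have t4 : 2 * (Q * σ) ≤ 2 * (Q * H) := by gcongr
  have t5 : 2 * (Q * H) + k * Q * (H + 1) * H * (1 + Real.log Q) ≤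
      3 * k * Q * (H + 1) ^ 2 * (1 + Real.log Q) := by
    have : (1 : ℝ) * 1 ≤ k * (1 + Real.log Q) := by gcongr; linarith
    have a := mul_le_mul_of_nonneg_left this (by positivity : (0 : ℝ) ≤ 2 * Q * H)
    have b : 0 ≤ k * Q * (1 + Real.log Q) * (2 * H ^ 2 + 3 * H + 3) := by positivity
    nlinarith [a, b]
  linarith

/-! ### Collisions with zero shift -/

lemma sum_gcd_le (u : ℕ) :
    ∑ d ∈ Finset.Icc 1 (2 * u), (Nat.gcd d u : ℝ) ≤ 2 * u * u.divisors.card := by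
  rcases Nat.eq_zero_or_pos u with rfl | hu
  · simp
  calc ∑ d ∈ Finset.Icc 1 (2 * u), (Nat.gcd d u : ℝ)
      ≤ ∑ d ∈ Finset.Icc 1 (2 * u), ∑ g ∈ u.divisors, if g ∣ d then (g : ℝ) else 0 := by
        refine Finset.sum_le_sum fun d _ => ?_
        have hm : Nat.gcd d u ∈ u.divisors := Nat.mem_divisors.2 ⟨Nat.gcd_dvd_right _ _, hu.ne'⟩
        refine le_trans (le_of_eq ?_) (Finset.single_le_sum
          (f := fun g : ℕ => if g ∣ d then (g : ℝ) else 0) (fun g _ => ?_) hm)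
        · simp [Nat.gcd_dvd_left]
        · positivity
    _ = ∑ g ∈ u.divisors, ∑ d ∈ (Finset.Icc 1 (2 * u)).filter (fun d => g ∣ d), (g : ℝ) := by
        rw [Finset.sum_comm]
        exact Finset.sum_congr rfl fun g _ => (Finset.sum_filter _ _).symm
    _ ≤ ∑ g ∈ u.divisors, (2 * u : ℝ) := by
        refine Finset.sum_le_sum fun g hg => ?_
        have hg0 : 0 < g := Nat.pos_of_mem_divisors hg
        have hg1 : (0 : ℝ) < g := by exact_mod_cast hg0
        have := sum_filter_dvd_one_le (Q := 2 * u) hg0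
        have h2 : ∑ d ∈ (Finset.Icc 1 (2 * u)).filter (fun d => g ∣ d), (g : ℝ) =
            g * ∑ d ∈ (Finset.Icc 1 (2 * u)).filter (fun d => g ∣ d), (1 : ℝ) := by
          rw [Finset.mul_sum]; simp
        rw [h2]
        calc _ ≤ (g : ℝ) * (((2 * u : ℕ) : ℝ) / g) := by gcongr
          _ = 2 * u := by push_cast; field_simp
    _ = _ := by rw [Finset.sum_const, nsmul_eq_mul]; ring

lemma sum_card_divisors_le (Q : ℕ) :
    ∑ u ∈ Finset.Icc 1 Q, (u.divisors.card : ℝ) ≤ Q * (1 + Real.log Q) := by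
  have h : ∀ u ∈ Finset.Icc 1 Q, (u.divisors.card : ℝ) =
      (((Finset.Icc 1 Q).filter (fun r => r ∣ u)).card : ℝ) * 1 := by
    intro u hu
    obtain ⟨h1, h2⟩ := Finset.mem_Icc.1 hu
    rw [mul_one]
    congr 2
    ext r
    simp only [Nat.mem_divisors, Finset.mem_filter, Finset.mem_Icc]
    constructor
    · rintro ⟨hr, -⟩
      exact ⟨⟨Nat.pos_of_dvd_of_pos hr h1, (Nat.le_of_dvd h1 hr).trans h2⟩, hr⟩
    · rintro ⟨-, hr⟩
      exact ⟨hr, by omega⟩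
  rw [Finset.sum_congr rfl h, sum_card_filter_dvd_mul (Finset.Icc 1 Q) Q (fun _ => (1 : ℝ))]
  calc _ ≤ ∑ r ∈ Finset.Icc 1 Q, (Q * (1 / r) : ℝ) := by
        refine Finset.sum_le_sum fun r hr => ?_
        exact (sum_filter_dvd_one_le (Finset.mem_Icc.1 hr).1).trans (le_of_eq (by ring))
    _ ≤ _ := by
        rw [← Finset.mul_sum]
        gcongr
        exact sum_Icc_one_div_le Q

/-- The factor multiplying `ξ - ξ'` exceeds `2wQ`, while the one multiplying `η' - η` is positive
and at most `4wQ`. -/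
lemma sub_mem_Icc_of_mem_collisions_zero {w k Q : ℕ} (hw : 0 < w) (hk : 0 < k) (hQ : 0 < Q)
    {y₀ x x' y y' : ℤ} (hy₀ : 0 ≤ y₀) (hy₀' : y₀ < 2 * w)
    (hp : (x, x', y, y') ∈ collisions w k Q y₀ 0) :
    1 ≤ x - x' ∧ x - x' ≤ 2 * (y' - y) := by
  obtain ⟨⟨⟨a1, a2⟩, ⟨a3, a4⟩, ⟨a5, a6⟩, a7, a8⟩, a9, e⟩ := mem_collisions.1 hp
  have hwz : (0 : ℤ) < w := by exact_mod_cast hw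
  have hkz : (1 : ℤ) ≤ k := by exact_mod_cast hk
  have hQz : (0 : ℤ) < Q := by exact_mod_cast hQ
  have hk2 : (Q : ℤ) ≤ k ^ 2 * Q := le_mul_of_one_le_left hQz.le (one_le_pow₀ hkz)
  have E1 : w * (2 * Q) < 1 + w * (x + x') := by
    have : (w : ℤ) * (2 * Q) ≤ w * (x + x') := mul_le_mul_of_nonneg_left (by linarith) hwz.le
    linarith
  have V1 : y₀ + w * (y + y') ≤ w * (4 * Q) := by
    have : (w : ℤ) * (y + y') ≤ w * (4 * Q - 2) := mul_le_mul_of_nonneg_left (by omega) hwz.le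
    linarith
  have V2 : 0 < y₀ + w * (y + y') := by
    have : (w : ℤ) * 1 ≤ w * (y + y') := mul_le_mul_of_nonneg_left (by omega) hwz.le
    linarith
  have E0 : (0 : ℤ) < w * (2 * Q) := by positivity
  have hd : 0 < x - x' := by
    refine pos_of_mul_pos_left (b := 1 + w * (x + x')) ?_ (by linarith)
    rw [e, add_zero]
    exact mul_pos (by linarith) V2
  refine ⟨hd, ?_⟩
  have h1 := mul_le_mul_of_nonneg_left E1.le hd.le
  have h2 := mul_le_mul_of_nonneg_left V1 (by linarith : 0 ≤ y' - y)
  refine le_of_mul_le_mul_right ?_ E0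
  linarith

/-- With `h = 0` the gcd is no longer confined to divisors of a fixed number, and averaging `gcd(d,
u)` costs a divisor function, hence a factor `log Q`. This bound is used only for the `A` pairs `α =
α'`. -/
lemma card_collisions_zero_le {w k Q : ℕ} (hw : 0 < w) (hk : 0 < k) (hQ : 0 < Q)
    {y₀ : ℤ} (hy₀ : 0 ≤ y₀) (hy₀' : y₀ < 2 * w) :
    ((collisions w k Q y₀ 0).card : ℝ) ≤ 4 * k * Q ^ 2 * (1 + Real.log Q) := by
  have hkr : (1 : ℝ) ≤ k := by exact_mod_cast hk
  have hQr : (1 : ℝ) ≤ Q := by exact_mod_cast hQ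
  have hlog : 0 ≤ Real.log Q := Real.log_nonneg hQr
  have h1 : ((collisions w k Q y₀ 0).card : ℝ) ≤ ∑ u ∈ Finset.Icc 1 Q,
      ∑ d ∈ Finset.Icc 1 (2 * u), (k * Q * (Nat.gcd d u) / u + 1 : ℝ) := by
    rw [Finset.card_eq_sum_card_fiberwise (f := fun p => (p.2.2.2 - p.2.2.1).toNat)
      (t := Finset.Icc 1 Q), Nat.cast_sum]
    · refine Finset.sum_le_sum fun u hu => ?_
      obtain ⟨hu1, hu2⟩ := Finset.mem_Icc.1 hu
      rw [Finset.card_eq_sum_card_fiberwise (f := fun p => (p.1 - p.2.1).toNat)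
        (t := Finset.Icc 1 (2 * u)), Nat.cast_sum]
      · refine Finset.sum_le_sum fun d hd => ?_
        obtain ⟨hd1, hd2⟩ := Finset.mem_Icc.1 hd
        refine le_trans (Nat.cast_le.2 (Finset.card_le_card ?_))
          (card_collisions_fiber w k Q hw y₀ 0 d u (by exact_mod_cast hu1))
        intro p hp
        obtain ⟨hp, hp1⟩ := Finset.mem_filter.1 hp
        obtain ⟨hp, hp2⟩ := Finset.mem_filter.1 hp
        exact Finset.mem_filter.2 ⟨hp, by omega, by omega⟩
      · rintro ⟨x, x', y, y'⟩ hp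
        obtain ⟨hp, hp2⟩ := Finset.mem_filter.1 (Finset.mem_coe.1 hp)
        have := sub_mem_Icc_of_mem_collisions_zero hw hk hQ hy₀ hy₀' hp
        simp only [Finset.coe_Icc, Set.mem_Icc] at hp2 ⊢
        omega
    · rintro ⟨x, x', y, y'⟩ hp
      obtain ⟨⟨-, -, ⟨a5, a6⟩, a7, a8⟩, a9, -⟩ := mem_collisions.1 (Finset.mem_coe.1 hp)
      simp only [Finset.coe_Icc, Set.mem_Icc]
      omega
  have h2 : ∀ u ∈ Finset.Icc 1 Q, ∑ d ∈ Finset.Icc 1 (2 * u), (k * Q * (Nat.gcd d u) / u + 1 : ℝ) ≤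
      2 * k * Q * u.divisors.card + 2 * Q := by
    intro u hu
    obtain ⟨hu1, hu2⟩ := Finset.mem_Icc.1 hu
    have hur : (1 : ℝ) ≤ u := by exact_mod_cast hu1
    have huQ : (u : ℝ) ≤ Q := by exact_mod_cast hu2
    rw [Finset.sum_add_distrib]
    have e : ∑ d ∈ Finset.Icc 1 (2 * u), (k * Q * (Nat.gcd d u) / u : ℝ) =
        k * Q / u * ∑ d ∈ Finset.Icc 1 (2 * u), (Nat.gcd d u : ℝ) := by
      rw [Finset.mul_sum]
      exact Finset.sum_congr rfl fun d _ => by ring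
    rw [e]
    have a := mul_le_mul_of_nonneg_left (sum_gcd_le u) (by positivity : (0 : ℝ) ≤ k * Q / u)
    have b : (k * Q / u : ℝ) * (2 * u * u.divisors.card) = 2 * k * Q * u.divisors.card := by
      field_simp
    simp only [Finset.sum_const, Nat.card_Icc, nsmul_eq_mul, mul_one, Nat.add_sub_cancel]
    push_cast
    linarith
  refine (h1.trans (Finset.sum_le_sum h2)).trans ?_
  rw [Finset.sum_add_distrib, ← Finset.mul_sum]
  simp only [Finset.sum_const, Nat.card_Icc, nsmul_eq_mul, Nat.add_sub_cancel]
  have a := mul_le_mul_of_nonneg_left (sum_card_divisors_le Q) (by positivity : (0 : ℝ) ≤ 2 * k * Q)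
  have b : (1 : ℝ) * 1 ≤ k * (1 + Real.log Q) := by gcongr; linarith
  have c := mul_le_mul_of_nonneg_left b (by positivity : (0 : ℝ) ≤ 2 * Q ^ 2)
  linarith

/-! ### Pairs of box points with equal values -/

/-- The parameter box for `(ξ, η, α)`. -/
noncomputable def box (k Q A : ℕ) : Finset (ℤ × ℤ × ℤ) :=
  Finset.Ico ((k ^ 2 * Q : ℕ) : ℤ) (((k ^ 2 + k) * Q : ℕ) : ℤ) ×ˢ
    Finset.Ico (Q : ℤ) ((2 * Q : ℕ) : ℤ) ×ˢ Finset.Icc (1 : ℤ) A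

/-- The sum of three squares with parameters `(ξ, η, α)`. -/
def boxValue (w : ℕ) (y₀ a₀ : ℤ) (p : ℤ × ℤ × ℤ) : ℤ :=
  (1 + 2 * w * p.1) ^ 2 + (y₀ + 2 * w * p.2.1) ^ 2 + (a₀ + 2 * w * p.2.2) ^ 2

lemma mem_box {k Q A : ℕ} {x y a : ℤ} : (x, y, a) ∈ box k Q A ↔
    ((k ^ 2 * Q : ℤ) ≤ x ∧ x < (k ^ 2 + k) * Q) ∧ ((Q : ℤ) ≤ y ∧ y < 2 * Q) ∧ 1 ≤ a ∧ a ≤ A := by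
  simp only [box, Finset.mem_product, Finset.mem_Ico, Finset.mem_Icc]
  push_cast
  rfl

lemma card_box (k Q A : ℕ) : (box k Q A).card = k * Q * (Q * A) := by
  simp only [box, Finset.card_product, Int.card_Ico, Int.card_Icc]
  congr 1
  · push_cast
    have : ((k : ℤ) ^ 2 + k) * Q - k ^ 2 * Q = ((k * Q : ℕ) : ℤ) := by push_cast; ring
    rw [this, Int.toNat_natCast]
  · congr 1 <;> omega

/-- The difference of the third squares, divided by `4w`. -/
def shift (w : ℕ) (a₀ a a' : ℤ) : ℤ := (a' - a) * (a₀ + w * (a + a'))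

lemma boxValue_eq_iff {w : ℕ} (hw : 0 < w) {y₀ a₀ x y a x' y' a' : ℤ} :
    boxValue w y₀ a₀ (x, y, a) = boxValue w y₀ a₀ (x', y', a') ↔
      (x - x') * (1 + w * (x + x')) = (y' - y) * (y₀ + w * (y + y')) + shift w a₀ a a' := by
  have hwz : (4 * w : ℤ) ≠ 0 := by positivity
  unfold boxValue shift
  constructor
  · intro h
    apply mul_left_cancel₀ hwz
    linear_combination h
  · intro h
    linear_combination (4 * w : ℤ) * h

lemma abs_shift_le {w A : ℕ} {a₀ a a' : ℤ} (ha₀ : 0 ≤ a₀) (ha₀' : a₀ < 2 * w)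
    (ha : 1 ≤ a ∧ a ≤ A) (ha' : 1 ≤ a' ∧ a' ≤ A) : |shift w a₀ a a'| ≤ 2 * w * (A + 1) ^ 2 := by
  have hwz : (0 : ℤ) ≤ w := by positivity
  have h1 : |a' - a| ≤ A + 1 := abs_le.2 ⟨by omega, by omega⟩
  have h2 : |a₀ + w * (a + a')| ≤ 2 * w * (A + 1) := by
    have h3 : (w : ℤ) * (a + a') ≤ w * (2 * A) := mul_le_mul_of_nonneg_left (by omega) hwz
    have h4 : 0 ≤ (w : ℤ) * (a + a') := mul_nonneg hwz (by omega)
    exact abs_le.2 ⟨by linarith, by linarith⟩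
  rw [shift, abs_mul]
  calc |a' - a| * |a₀ + w * (a + a')| ≤ (A + 1) * (2 * w * (A + 1)) := by gcongr
    _ = _ := by ring

lemma shift_eq_zero_iff {w : ℕ} (hw : 0 < w) {a₀ a a' : ℤ} (ha₀ : 0 ≤ a₀)
    (ha : 1 ≤ a) (ha' : 1 ≤ a') : shift w a₀ a a' = 0 ↔ a' = a := by
  have hwz : (0 : ℤ) < w := by exact_mod_cast hw
  have : a₀ + w * (a + a') ≠ 0 := by
    have : 0 < (w : ℤ) * (a + a') := mul_pos hwz (by omega)
    omega
  rw [shift, mul_eq_zero, or_iff_left this, sub_eq_zero]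

/-- The pairs of box points with equal values. -/
noncomputable def equalPairs (w k Q A : ℕ) (y₀ a₀ : ℤ) : Finset ((ℤ × ℤ × ℤ) × ℤ × ℤ × ℤ) :=
  (box k Q A ×ˢ box k Q A).filter (fun q => boxValue w y₀ a₀ q.1 = boxValue w y₀ a₀ q.2)

/-- If `η = η'` then `(ξ - ξ')(1 + w(ξ+ξ'))` equals the shift. The shift is at most `Q` in absolute
value and the second factor is larger, so both sides vanish and the two points coincide. -/
lemma card_equalPairs_diag_le {w k Q A : ℕ} (hw : 0 < w) (hk : 0 < k) (hQ : 0 < Q)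
    {y₀ a₀ : ℤ} (ha₀ : 0 ≤ a₀) (ha₀' : a₀ < 2 * w) (hA : 2 * w * (A + 1) ^ 2 ≤ Q) :
    ((equalPairs w k Q A y₀ a₀).filter (fun q => q.1.2.1 = q.2.2.1)).card ≤ k * Q * (Q * A) := by
  rw [← card_box]
  refine Finset.card_le_card_of_injOn (fun q => q.1) ?_ ?_
  · intro q hq
    exact (Finset.mem_product.1 (Finset.mem_filter.1 (Finset.mem_filter.1
      (Finset.mem_coe.1 hq)).1).1).1
  · have key : ∀ q ∈ (equalPairs w k Q A y₀ a₀).filter (fun q => q.1.2.1 = q.2.2.1),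
        q.2 = q.1 := by
      rintro ⟨⟨x, y, a⟩, x', y', a'⟩ hq
      obtain ⟨hq, h1⟩ := Finset.mem_filter.1 hq
      obtain ⟨hq, h2⟩ := Finset.mem_filter.1 hq
      obtain ⟨hb, hb'⟩ := Finset.mem_product.1 hq
      obtain ⟨⟨a1, a2⟩, -, a3⟩ := mem_box.1 hb
      obtain ⟨⟨b1, b2⟩, -, b3⟩ := mem_box.1 hb'
      simp only at h1 h2
      subst h1
      rw [boxValue_eq_iff hw, sub_self, zero_mul, zero_add] at h2
      have hwz : (1 : ℤ) ≤ w := by exact_mod_cast hw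
      have hkz : (1 : ℤ) ≤ k := by exact_mod_cast hk
      have hQz : (0 : ℤ) < Q := by exact_mod_cast hQ
      have hk2 : (Q : ℤ) ≤ k ^ 2 * Q := le_mul_of_one_le_left hQz.le (one_le_pow₀ hkz)
      have hs := abs_shift_le ha₀ ha₀' a3 b3
      have hA' : (2 * w * (A + 1) ^ 2 : ℤ) ≤ Q := by exact_mod_cast hA
      have hE : (Q : ℤ) < 1 + w * (x + x') := by
        have : (1 : ℤ) * (2 * Q) ≤ w * (x + x') := mul_le_mul hwz (by linarith) (by linarith)
          (by linarith)
        linarith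
      have hx : x - x' = 0 := by
        by_contra hne
        have h3 : 1 ≤ |x - x'| := Int.one_le_abs hne
        have h4 : |x - x'| * |1 + w * (x + x')| ≤ Q := by
          rw [← abs_mul, h2]; linarith
        have h5 : (1 : ℤ) * |1 + w * (x + x')| ≤ |x - x'| * |1 + w * (x + x')| := by gcongr
        have h6 := le_abs_self (1 + (w : ℤ) * (x + x'))
        linarith
      rw [hx, zero_mul] at h2
      have := (shift_eq_zero_iff hw ha₀ a3.1 b3.1).1 h2.symm
      ext <;> simp only <;> omega
    intro q hq r hr hqr
    have h1 := key q hq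
    have h2 := key r hr
    simp only at hqr
    ext1
    · exact hqr
    · rw [h1, h2, hqr]

lemma card_equalPairs_lt_le {w k Q A : ℕ} (hw : 0 < w) {y₀ a₀ : ℤ} :
    ((equalPairs w k Q A y₀ a₀).filter (fun q => q.1.2.1 < q.2.2.1)).card ≤
      ∑ a ∈ Finset.Icc (1 : ℤ) A, ∑ a' ∈ Finset.Icc (1 : ℤ) A,
        (collisions w k Q y₀ (shift w a₀ a a')).card := by
  rw [← Finset.sum_product', Finset.card_eq_sum_card_fiberwise (f := fun q => (q.1.2.2, q.2.2.2))
    (t := Finset.Icc (1 : ℤ) A ×ˢ Finset.Icc (1 : ℤ) A)]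
  · refine Finset.sum_le_sum fun c _ => ?_
    refine Finset.card_le_card_of_injOn (fun q => (q.1.1, q.2.1, q.1.2.1, q.2.2.1)) ?_ ?_
    · rintro ⟨⟨x, y, a⟩, x', y', a'⟩ hq
      obtain ⟨hq, h0⟩ := Finset.mem_filter.1 (Finset.mem_coe.1 hq)
      obtain ⟨hq, h1⟩ := Finset.mem_filter.1 hq
      obtain ⟨hq, h2⟩ := Finset.mem_filter.1 hq
      obtain ⟨hb, hb'⟩ := Finset.mem_product.1 hq
      obtain ⟨c1, c2, c3⟩ := mem_box.1 hb
      obtain ⟨c1', c2', c3'⟩ := mem_box.1 hb'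
      subst h0
      exact Finset.mem_coe.2 (mem_collisions.2
        ⟨⟨c1, c1', c2, c2'⟩, h1, (boxValue_eq_iff hw).1 h2⟩)
    · rintro ⟨⟨x, y, a⟩, x', y', a'⟩ hq ⟨⟨z, t, b⟩, z', t', b'⟩ hr hqr
      obtain ⟨-, h0⟩ := Finset.mem_filter.1 (Finset.mem_coe.1 hq)
      obtain ⟨-, h0'⟩ := Finset.mem_filter.1 (Finset.mem_coe.1 hr)
      rw [← h0'] at h0
      simp only [Prod.mk.injEq] at hqr h0 ⊢
      tauto
  · rintro ⟨⟨x, y, a⟩, x', y', a'⟩ hq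
    obtain ⟨hq, h1⟩ := Finset.mem_filter.1 (Finset.mem_coe.1 hq)
    obtain ⟨hq, h2⟩ := Finset.mem_filter.1 hq
    obtain ⟨hb, hb'⟩ := Finset.mem_product.1 hq
    obtain ⟨c1, c2, c3⟩ := mem_box.1 hb
    obtain ⟨c1', c2', c3'⟩ := mem_box.1 hb'
    exact Finset.mem_coe.2 (Finset.mem_product.2 ⟨Finset.mem_Icc.2 c3, Finset.mem_Icc.2 c3'⟩)

lemma card_equalPairs_le_aux {w k Q A : ℕ} (hw : 0 < w) (hk : 0 < k) (hQ : 0 < Q)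
    {y₀ a₀ : ℤ} (ha₀ : 0 ≤ a₀) (ha₀' : a₀ < 2 * w) (hA : 2 * w * (A + 1) ^ 2 ≤ Q) :
    (equalPairs w k Q A y₀ a₀).card ≤ k * Q * (Q * A) +
      2 * ∑ a ∈ Finset.Icc (1 : ℤ) A, ∑ a' ∈ Finset.Icc (1 : ℤ) A,
        (collisions w k Q y₀ (shift w a₀ a a')).card := by
  set s := equalPairs w k Q A y₀ a₀ with hs
  have h1 := card_equalPairs_diag_le (y₀ := y₀) hw hk hQ ha₀ ha₀' hA
  have h2 := card_equalPairs_lt_le (k := k) (Q := Q) (A := A) (y₀ := y₀) (a₀ := a₀) hw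
  -- Swapping the two points exchanges `η < η'` with `η > η'`; hence the factor `2`.
  have h3 : (s.filter (fun q => q.2.2.1 < q.1.2.1)).card ≤
      (s.filter (fun q => q.1.2.1 < q.2.2.1)).card := by
    refine Finset.card_le_card_of_injOn Prod.swap ?_ Prod.swap_injective.injOn
    intro q hq
    obtain ⟨hq, hlt⟩ := Finset.mem_filter.1 (Finset.mem_coe.1 hq)
    obtain ⟨hq, h⟩ := Finset.mem_filter.1 hq
    obtain ⟨hb, hb'⟩ := Finset.mem_product.1 hq
    exact Finset.mem_coe.2 (Finset.mem_filter.2 ⟨Finset.mem_filter.2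
      ⟨Finset.mem_product.2 ⟨hb', hb⟩, h.symm⟩, hlt⟩)
  have h4 : s ⊆ s.filter (fun q => q.1.2.1 = q.2.2.1) ∪
      (s.filter (fun q => q.1.2.1 < q.2.2.1) ∪ s.filter (fun q => q.2.2.1 < q.1.2.1)) := by
    intro q hq
    simp only [Finset.mem_union, Finset.mem_filter]
    rcases lt_trichotomy q.1.2.1 q.2.2.1 with h | h | h <;> tauto
  have h5 := (Finset.card_le_card h4).trans ((Finset.card_union_le _ _).trans
    (Nat.add_le_add_left (Finset.card_union_le _ _) _))
  rw [← hs] at h1 h2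
  linarith

/-! ### Averaging the divisor sums over the shifts -/

/-- A divisor `r` of `mn` is recovered from the pair `(gcd(r, m), r / gcd(r, m))`, whose entries
divide `m` and `n`. It is applied to the two factors of `shift`. -/
lemma sumInvDivisors_mul_le (w : ℕ) {m n : ℕ} (hm : 0 < m) (hn : 0 < n) :
    sumInvDivisors w (m * n) ≤
      ∑ r ∈ coprimeDivisors w m ×ˢ coprimeDivisors w n, (1 / (r.1 * r.2) : ℝ) := by
  set e : ℕ → ℕ × ℕ := fun r => (Nat.gcd r m, r / Nat.gcd r m)
  have hprod : ∀ r, (e r).1 * (e r).2 = r := fun r => Nat.mul_div_cancel' (Nat.gcd_dvd_left _ _)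
  have hinj : Set.InjOn e (coprimeDivisors w (m * n)) := by
    intro a _ b _ hab
    rw [← hprod a, ← hprod b, hab]
  have h1 : sumInvDivisors w (m * n) =
      ∑ r ∈ (coprimeDivisors w (m * n)).image e, (1 / (r.1 * r.2) : ℝ) := by
    rw [Finset.sum_image hinj, sumInvDivisors]
    refine Finset.sum_congr rfl fun r _ => ?_
    rw [← Nat.cast_mul, hprod]
  rw [h1]
  refine Finset.sum_le_sum_of_subset_of_nonneg ?_ fun _ _ _ => by positivity
  intro p hp
  obtain ⟨r, hr, rfl⟩ := Finset.mem_image.1 hp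
  obtain ⟨hr, hc⟩ := Finset.mem_filter.1 hr
  have hr' := (Nat.mem_divisors.1 hr).1
  have hr0 : 0 < r := Nat.pos_of_mem_divisors hr
  have hd2 : (e r).2 ∣ n := by
    have hg : 0 < Nat.gcd r m := Nat.gcd_pos_of_pos_left _ hr0
    obtain ⟨c, hc'⟩ := Nat.gcd_dvd_right r m
    refine Nat.Coprime.dvd_of_dvd_mul_left (Nat.coprime_div_gcd_div_gcd hg)
      (k := r / Nat.gcd r m) (m := m / Nat.gcd r m) ?_
    rw [← Nat.mul_dvd_mul_iff_left hg, Nat.mul_div_cancel' (Nat.gcd_dvd_left _ _), ← mul_assoc,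
      Nat.mul_div_cancel' (Nat.gcd_dvd_right _ _)]
    exact hr'
  refine Finset.mem_product.2 ⟨Finset.mem_filter.2 ⟨?_, ?_⟩, Finset.mem_filter.2 ⟨?_, ?_⟩⟩
  · exact Nat.mem_divisors.2 ⟨Nat.gcd_dvd_right _ _, hm.ne'⟩
  · exact hc.coprime_dvd_left (Nat.gcd_dvd_left _ _)
  · exact Nat.mem_divisors.2 ⟨hd2, hn.ne'⟩
  · exact hc.coprime_dvd_left (Nat.div_dvd_of_dvd (Nat.gcd_dvd_left _ _))

/-- The positive integers up to `N` that are coprime to `w`. -/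
def coprimeIcc (w N : ℕ) : Finset ℕ := (Finset.Icc 1 N).filter (fun r => r.Coprime w)

lemma coprimeDivisors_eq_filter {w m N : ℕ} (hm : 0 < m) (hN : m ≤ N) :
    coprimeDivisors w m = (coprimeIcc w N).filter (fun r => r ∣ m) := by
  ext r
  simp only [coprimeDivisors, coprimeIcc, Finset.mem_filter, Nat.mem_divisors, Finset.mem_Icc]
  constructor
  · rintro ⟨⟨h1, -⟩, h2⟩
    exact ⟨⟨⟨Nat.pos_of_dvd_of_pos h1 hm, (Nat.le_of_dvd hm h1).trans hN⟩, h2⟩, h1⟩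
  · rintro ⟨⟨-, h2⟩, h1⟩
    exact ⟨⟨h1, hm.ne'⟩, h2⟩

/-- As `s` is coprime to `w`, both conditions fix `a'`, hence its class modulo `lcm(r, s)`, which is
at least `√(rs)`. This crude bound suffices: after weighting by `1/(rs)` it leaves a product of two
convergent series. -/
lemma card_filter_dvd_shift_le {w A : ℕ} (a₀ a : ℤ) {r s : ℕ} (hr : 0 < r)
    (hs : 0 < s) (hsw : s.Coprime w) :
    (((Finset.Icc (1 : ℤ) A).filter
      (fun a' => (r : ℤ) ∣ a' - a ∧ (s : ℤ) ∣ a₀ + w * (a + a'))).card : ℝ) ≤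
        A / (√r * √s) + 1 := by
  have hl : 0 < Nat.lcm r s := Nat.lcm_pos hr hs
  have h1 := card_le_of_pairwise_dvd_sub ((Finset.Icc (1 : ℤ) A).filter
      (fun a' => (r : ℤ) ∣ a' - a ∧ (s : ℤ) ∣ a₀ + w * (a + a'))) (Nat.lcm r s)
      (by exact_mod_cast hl) A (Nat.cast_nonneg _) ?_ ?_
  · refine h1.trans ?_
    have hr1 : (0 : ℝ) < √r := Real.sqrt_pos.2 (by exact_mod_cast hr)
    have hs1 : (0 : ℝ) < √s := Real.sqrt_pos.2 (by exact_mod_cast hs)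
    have h2 : √(r : ℝ) * √s ≤ (Nat.lcm r s : ℝ) := by
      rw [← Real.mul_self_sqrt (Nat.cast_nonneg (Nat.lcm r s))]
      gcongr
      · exact Nat.le_of_dvd hl (Nat.dvd_lcm_left _ _)
      · exact Nat.le_of_dvd hl (Nat.dvd_lcm_right _ _)
    have h3 : (A : ℝ) / ((Nat.lcm r s : ℤ) : ℝ) ≤ A / (√r * √s) := by
      rw [Int.cast_natCast]
      gcongr
    linarith
  · intro x hx y hy
    obtain ⟨-, hx1, hx2⟩ := Finset.mem_filter.1 hx
    obtain ⟨-, hy1, hy2⟩ := Finset.mem_filter.1 hy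
    have k1 : (r : ℤ) ∣ x - y := by
      have := dvd_sub hx1 hy1
      rwa [sub_sub_sub_cancel_right] at this
    have k2 : (s : ℤ) ∣ w * (x - y) := by
      have := dvd_sub hx2 hy2
      have e : a₀ + w * (a + x) - (a₀ + w * (a + y)) = w * (x - y) := by ring
      rwa [e] at this
    have k3 : (s : ℤ) ∣ x - y := (Nat.isCoprime_iff_coprime.2 hsw).dvd_of_dvd_mul_left k2
    rw [Int.natCast_dvd] at k1 k3 ⊢
    exact Nat.lcm_dvd k1 k3
  · intro x hx y hy
    have hx := Finset.mem_Icc.1 (Finset.mem_filter.1 hx).1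
    have hy := Finset.mem_Icc.1 (Finset.mem_filter.1 hy).1
    have : x - y ≤ A := by omega
    exact_mod_cast this

/-- The term `A/√(rs)` of the previous count produces `A z²`; the `+1`, weighted by `1/(rs)` over
`r, s ≤ 2w(A+1)`, produces the squared logarithm. -/
lemma sum_sumInvDivisors_shift_le {w A : ℕ} (hw : 0 < w) {a₀ a : ℤ} {z : ℝ}
    (ha₀ : 0 ≤ a₀) (ha₀' : a₀ < 2 * w) (ha : 1 ≤ a) (haA : a ≤ A)
    (hz : ∀ N, ∑ r ∈ coprimeIcc w N, (1 / (r * √r) : ℝ) ≤ z) :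
    ∑ a' ∈ (Finset.Icc (1 : ℤ) A).filter (fun a' => a' ≠ a),
      sumInvDivisors w (shift w a₀ a a').natAbs ≤
        A * z ^ 2 + (1 + Real.log (2 * w * (A + 1))) ^ 2 := by
  set N := 2 * w * (A + 1)
  have hwz : (0 : ℤ) < w := by exact_mod_cast hw
  set C := coprimeIcc w N
  have hpos : ∀ r ∈ C, 0 < r := fun r hr =>
    (Finset.mem_Icc.1 (Finset.mem_filter.1 hr).1).1
  have h1 : ∀ a' ∈ (Finset.Icc (1 : ℤ) A).filter (fun a' => a' ≠ a),
      sumInvDivisors w (shift w a₀ a a').natAbs ≤ ∑ r ∈ C ×ˢ C,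
        if (r.1 : ℤ) ∣ a' - a ∧ (r.2 : ℤ) ∣ a₀ + w * (a + a') then (1 / (r.1 * r.2) : ℝ) else 0 := by
    intro a' ha'
    obtain ⟨ha', hne⟩ := Finset.mem_filter.1 ha'
    obtain ⟨b1, b2⟩ := Finset.mem_Icc.1 ha'
    have hB : 0 < (w : ℤ) * (a + a') := mul_pos hwz (by omega)
    have hB' : (w : ℤ) * (a + a') ≤ w * (2 * A) := mul_le_mul_of_nonneg_left (by omega) hwz.le
    have hs1 : 0 < (a' - a).natAbs := Int.natAbs_pos.2 (sub_ne_zero.2 hne)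
    have hs2 : 0 < (a₀ + w * (a + a')).natAbs := Int.natAbs_pos.2 (by omega)
    have hN1 : (a' - a).natAbs ≤ N := by
      have : (a' - a).natAbs ≤ A := by omega
      refine this.trans ?_
      calc A ≤ 1 * (A + 1) := by omega
        _ ≤ _ := Nat.mul_le_mul_right _ (by omega)
    have hN2 : (a₀ + w * (a + a')).natAbs ≤ N := by
      zify
      rw [abs_of_nonneg (by omega)]
      simp only [N]
      push_cast
      linarith
    rw [shift, Int.natAbs_mul]
    refine (sumInvDivisors_mul_le w hs1 hs2).trans (le_of_eq ?_)
    rw [coprimeDivisors_eq_filter hs1 hN1, coprimeDivisors_eq_filter hs2 hN2,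
      ← Finset.filter_product, Finset.sum_filter]
    refine Finset.sum_congr rfl fun r _ => ?_
    simp only [Int.natCast_dvd]
  refine (Finset.sum_le_sum h1).trans ?_
  rw [Finset.sum_comm]
  have h2 : ∀ r ∈ C ×ˢ C, ∑ a' ∈ (Finset.Icc (1 : ℤ) A).filter (fun a' => a' ≠ a),
      (if (r.1 : ℤ) ∣ a' - a ∧ (r.2 : ℤ) ∣ a₀ + w * (a + a') then (1 / (r.1 * r.2) : ℝ) else 0) ≤
      A * (1 / (r.1 * √r.1) * (1 / (r.2 * √r.2))) + 1 / r.1 * (1 / r.2) := by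
    rintro ⟨r, s⟩ hrs
    obtain ⟨hr, hs⟩ := Finset.mem_product.1 hrs
    have hr0 := hpos r hr
    have hs0 := hpos s hs
    have h3 := card_filter_dvd_shift_le (A := A) a₀ a hr0 hs0 (Finset.mem_filter.1 hs).2
    simp only
    rw [← Finset.sum_filter, Finset.sum_const, nsmul_eq_mul]
    have h4 : ((((Finset.Icc (1 : ℤ) A).filter (fun a' => a' ≠ a)).filter
        (fun a' => (r : ℤ) ∣ a' - a ∧ (s : ℤ) ∣ a₀ + w * (a + a'))).card : ℝ) ≤
        A / (√r * √s) + 1 := by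
      refine le_trans (Nat.cast_le.2 (Finset.card_le_card ?_)) h3
      exact Finset.filter_subset_filter _ (Finset.filter_subset _ _)
    have hr1 : (0 : ℝ) < √r := Real.sqrt_pos.2 (by exact_mod_cast hr0)
    have hs1 : (0 : ℝ) < √s := Real.sqrt_pos.2 (by exact_mod_cast hs0)
    have hr2 : (0 : ℝ) < r := by exact_mod_cast hr0
    have hs2 : (0 : ℝ) < s := by exact_mod_cast hs0
    calc _ ≤ (A / (√r * √s) + 1) * (1 / (r * s) : ℝ) := by gcongr
      _ = _ := by field_simp
  refine (Finset.sum_le_sum h2).trans ?_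
  have h5 : ∀ f : ℕ → ℝ, ∑ r ∈ C ×ˢ C, f r.1 * f r.2 = (∑ r ∈ C, f r) ^ 2 := fun f => by
    rw [pow_two, Finset.sum_mul_sum, Finset.sum_product]
  rw [Finset.sum_add_distrib, ← Finset.mul_sum, h5 fun r => 1 / (r * √r), h5 fun r => 1 / r]
  have z0 : 0 ≤ ∑ r ∈ C, (1 / (r * √r) : ℝ) := Finset.sum_nonneg fun _ _ => by positivity
  have l0 : 0 ≤ ∑ r ∈ C, (1 / r : ℝ) := Finset.sum_nonneg fun _ _ => by positivity
  have l1 : ∑ r ∈ C, (1 / r : ℝ) ≤ 1 + Real.log (2 * w * (A + 1)) := by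
    refine le_trans (Finset.sum_le_sum_of_subset_of_nonneg (Finset.filter_subset _ _)
      fun _ _ _ => by positivity) ((sum_Icc_one_div_le N).trans (le_of_eq ?_))
    simp only [N]
    push_cast
    rfl
  gcongr
  exact hz N

/-- The main bound for the number of coincidences. -/
lemma card_equalPairs_le {w k Q A : ℕ} (hw : 0 < w) (hw2 : 2 ∣ w) (hk : 0 < k) (hQ : 0 < Q)
    {y₀ a₀ : ℤ} {z : ℝ} (hy₀ : 0 ≤ y₀) (hy₀' : y₀ < 2 * w) (ha₀ : 0 ≤ a₀) (ha₀' : a₀ < 2 * w)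
    (hA : 2 * w * (A + 1) ^ 2 ≤ Q)
    (hz : ∀ N, ∑ r ∈ coprimeIcc w N, (1 / (r * √r) : ℝ) ≤ z) :
    ((equalPairs w k Q A y₀ a₀).card : ℝ) ≤
      A ^ 2 * Q ^ 2 / (2 * k * w) * (1 + 10 / k) * z ^ 2 +
      A * Q ^ 2 * (k + 8 * k * (1 + Real.log Q) +
        (1 + 10 / k) * (1 + Real.log (2 * w * (A + 1))) ^ 2) +
      6 * k * Q * A ^ 2 * (2 * w * (A + 1) ^ 2 + 1) ^ 2 * (1 + Real.log Q) := by
  have hkr : (1 : ℝ) ≤ k := by exact_mod_cast hk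
  have hQr : (1 : ℝ) ≤ Q := by exact_mod_cast hQ
  have hwr : (1 : ℝ) ≤ w := by exact_mod_cast hw
  have hlog : 0 ≤ Real.log Q := Real.log_nonneg hQr
  set c : ℝ := Q ^ 2 / (4 * k * w) * (1 + 10 / k) with hc
  set T₀ : ℝ := 4 * k * Q ^ 2 * (1 + Real.log Q)
  set E : ℝ := 3 * k * Q * (2 * w * (A + 1) ^ 2 + 1) ^ 2 * (1 + Real.log Q)
  set Λ : ℝ := (1 + Real.log (2 * w * (A + 1))) ^ 2
  have hE : 0 ≤ E := by positivity
  have h1 := card_equalPairs_le_aux (y₀ := y₀) hw hk hQ ha₀ ha₀' hA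
  have h2 : ((equalPairs w k Q A y₀ a₀).card : ℝ) ≤ k * Q * (Q * A) +
      2 * ∑ a ∈ Finset.Icc (1 : ℤ) A, ∑ a' ∈ Finset.Icc (1 : ℤ) A,
        ((collisions w k Q y₀ (shift w a₀ a a')).card : ℝ) := by exact_mod_cast h1
  have h3 : ∀ a ∈ Finset.Icc (1 : ℤ) A, ∑ a' ∈ Finset.Icc (1 : ℤ) A,
      ((collisions w k Q y₀ (shift w a₀ a a')).card : ℝ) ≤
        T₀ + (c * (A * z ^ 2 + Λ) + A * E) := by
    intro a ha
    have ha' := Finset.mem_Icc.1 ha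
    -- The term `a' = a` has zero shift and gets the weaker bound `T₀`; the other terms are averaged
    -- through the divisor sums.
    rw [← Finset.sum_filter_add_sum_filter_not _ (fun a' => a' = a)]
    refine add_le_add ?_ ?_
    · rw [Finset.filter_eq', if_pos ha, Finset.sum_singleton]
      rw [(shift_eq_zero_iff hw ha₀ ha'.1 ha'.1).2 rfl]
      exact card_collisions_zero_le hw hk hQ hy₀ hy₀'
    · have h4 : ∀ a' ∈ (Finset.Icc (1 : ℤ) A).filter (fun a' => ¬ a' = a),
          ((collisions w k Q y₀ (shift w a₀ a a')).card : ℝ) ≤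
            c * sumInvDivisors w (shift w a₀ a a').natAbs + E := by
        intro a' hb
        obtain ⟨hb, hne⟩ := Finset.mem_filter.1 hb
        have hb' := Finset.mem_Icc.1 hb
        have hs := abs_shift_le ha₀ ha₀' ha' hb'
        have hA' : (2 * w * (A + 1) ^ 2 : ℤ) ≤ Q := by exact_mod_cast hA
        have h0 : shift w a₀ a a' ≠ 0 := fun h =>
          hne ((shift_eq_zero_iff hw ha₀ ha'.1 hb'.1).1 h)
        have h5 := card_collisions_le hw hw2 hk hQ hy₀ hy₀' (hs.trans hA') h0
        have h6 : ((shift w a₀ a a').natAbs : ℝ) ≤ 2 * w * (A + 1) ^ 2 := by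
          have : ((shift w a₀ a a').natAbs : ℤ) ≤ 2 * w * (A + 1) ^ 2 := by
            rwa [Int.natCast_natAbs]
          exact_mod_cast this
        refine h5.trans ?_
        simp only [E]
        gcongr
      refine (Finset.sum_le_sum h4).trans ?_
      rw [Finset.sum_add_distrib, ← Finset.mul_sum]
      refine add_le_add ?_ ?_
      · exact mul_le_mul_of_nonneg_left
          (sum_sumInvDivisors_shift_le hw ha₀ ha₀' ha'.1 ha'.2 hz) (by positivity)
      · rw [Finset.sum_const, nsmul_eq_mul]
        gcongr
        refine (Finset.card_filter_le _ _).trans (le_of_eq ?_)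
        rw [Int.card_Icc]; omega
  have h7 := Finset.sum_le_sum h3
  rw [Finset.sum_const, nsmul_eq_mul, Int.card_Icc] at h7
  have e : ((((A : ℤ) + 1 - 1).toNat : ℕ) : ℝ) = A := by
    congr 1; omega
  rw [e] at h7
  have h8 : 2 * c * Λ ≤ Q ^ 2 * (1 + 10 / k) * Λ := by
    have : 2 * c ≤ Q ^ 2 * (1 + 10 / k) := by
      have : (Q ^ 2 / (4 * k * w) : ℝ) ≤ Q ^ 2 / 2 := by
        gcongr
        nlinarith
      rw [hc]
      have h9 := mul_le_mul_of_nonneg_right this (by positivity : (0 : ℝ) ≤ 1 + 10 / k)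
      linarith
    have hΛ : 0 ≤ Λ := by positivity
    gcongr
  have h9 := mul_le_mul_of_nonneg_left h8 (by positivity : (0 : ℝ) ≤ A)
  have h10 : A ^ 2 * Q ^ 2 / (2 * k * w) * (1 + 10 / k) * z ^ 2 = 2 * A ^ 2 * c * z ^ 2 := by
    rw [hc]; field_simp; ring
  rw [h10]
  have h11 : 6 * k * Q * A ^ 2 * (2 * w * (A + 1) ^ 2 + 1) ^ 2 * (1 + Real.log Q) =
      2 * A ^ 2 * E := by simp only [E]; ring
  rw [h11]
  simp only [T₀] at h7
  linarith

/-! ### Cauchy–Schwarz and the choice of modulus -/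

lemma sq_card_le_card_image_mul {α β : Type*} [DecidableEq β] (s : Finset α)
    (f : α → β) :
    s.card ^ 2 ≤ (s.image f).card * ((s ×ˢ s).filter (fun q => f q.1 = f q.2)).card := by
  have h1 : ((s ×ˢ s).filter (fun q => f q.1 = f q.2)).card =
      ∑ b ∈ s.image f, (s.filter (fun a => f a = b)).card ^ 2 := by
    rw [Finset.card_eq_sum_card_fiberwise (f := fun q => f q.1) (t := s.image f)]
    · refine Finset.sum_congr rfl fun b _ => ?_
      rw [pow_two, ← Finset.card_product]
      congr 1
      ext ⟨x, y⟩
      simp only [Finset.mem_filter, Finset.mem_product]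
      constructor
      · rintro ⟨⟨⟨h1, h2⟩, h3⟩, h4⟩
        exact ⟨⟨h1, h4⟩, h2, h3 ▸ h4⟩
      · rintro ⟨⟨h1, h2⟩, h3, h4⟩
        exact ⟨⟨⟨h1, h3⟩, h2.trans h4.symm⟩, h2⟩
    · intro q hq
      have := (Finset.mem_product.1 (Finset.mem_filter.1 (Finset.mem_coe.1 hq)).1).1
      exact Finset.mem_coe.2 (Finset.mem_image_of_mem _ this)
  rw [h1, Finset.card_eq_sum_card_image f s]
  exact sq_sum_le_card_mul_sum_sq

lemma mem_coprimeIcc_eq_one_or_lt {w N P r : ℕ} (hw : ∀ p, p.Prime → p ≤ P → p ∣ w)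
    (hr : r ∈ coprimeIcc w N) : r = 1 ∨ P < r := by
  obtain ⟨h1, h2⟩ := Finset.mem_filter.1 hr
  by_contra! h
  obtain ⟨p, hp, hpr⟩ := Nat.exists_prime_and_dvd h.1
  have hpP : p ≤ P := (Nat.le_of_dvd (Finset.mem_Icc.1 h1).1 hpr).trans h.2
  exact Nat.not_coprime_of_dvd_of_dvd hp.one_lt hpr (hw p hp hpP) h2

/-- An integer coprime to all primes up to `P` is `1` or exceeds `P`, so beyond the term `1` only a
tail of the convergent series of `r^(-3/2)` remains. -/
lemma exists_sum_coprimeIcc_le {δ : ℝ} (hδ : 0 < δ) :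
    ∃ P : ℕ, ∀ w : ℕ, (∀ p, p.Prime → p ≤ P → p ∣ w) →
      ∀ N, ∑ r ∈ coprimeIcc w N, (1 / (r * √r) : ℝ) ≤ 1 + δ := by
  have hs : Summable (fun n : ℕ => (1 / (n * √n) : ℝ)) := by
    have := Real.summable_one_div_nat_rpow.2 (by norm_num : (1 : ℝ) < 3 / 2)
    refine this.congr fun n => ?_
    rcases Nat.eq_zero_or_pos n with rfl | hn
    · simp
    · have hn' : (0 : ℝ) < n := by exact_mod_cast hn
      rw [Real.sqrt_eq_rpow]
      congr 1
      rw [show (3 / 2 : ℝ) = 1 + 1 / 2 by norm_num, Real.rpow_add hn', Real.rpow_one]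
  obtain ⟨s, hs⟩ := summable_iff_vanishing_norm.1 hs δ hδ
  refine ⟨s.sup id + 1, fun w hw N => ?_⟩
  have h1 := hs ((coprimeIcc w N).filter (fun r => r ≠ 1)) ?_
  · have h2 : ∑ r ∈ (coprimeIcc w N).filter (fun r => ¬ r ≠ 1), (1 / (r * √r) : ℝ) ≤ 1 := by
      calc _ ≤ ∑ r ∈ ({1} : Finset ℕ), (1 / (r * √r) : ℝ) := by
            refine Finset.sum_le_sum_of_subset_of_nonneg ?_ fun _ _ _ => by positivity
            intro r hr
            simpa using (Finset.mem_filter.1 hr).2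
        _ = 1 := by simp
    rw [← Finset.sum_filter_add_sum_filter_not _ (fun r => r ≠ 1)]
    have := le_of_lt (lt_of_le_of_lt (Real.le_norm_self _) h1)
    linarith
  · refine Finset.disjoint_left.2 fun r hr hrs => ?_
    obtain ⟨hr, hr1⟩ := Finset.mem_filter.1 hr
    have h3 : r ≤ s.sup id := Finset.le_sup (f := id) hrs
    rcases mem_coprimeIcc_eq_one_or_lt hw hr with h | h
    · exact hr1 h
    · omega

lemma exists_dvd_sq_add_sq_sub_mul {m n c : ℤ} (hmn : IsCoprime m n)
    (hm : ∃ y a : ℤ, m ∣ y ^ 2 + a ^ 2 - c) (hn : ∃ y a : ℤ, n ∣ y ^ 2 + a ^ 2 - c) :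
    ∃ y a : ℤ, m * n ∣ y ^ 2 + a ^ 2 - c := by
  obtain ⟨y₁, a₁, h₁⟩ := hm
  obtain ⟨y₂, a₂, h₂⟩ := hn
  obtain ⟨u, v, huv⟩ := id hmn
  refine ⟨y₁ * (v * n) + y₂ * (u * m), a₁ * (v * n) + a₂ * (u * m), hmn.mul_dvd ?_ ?_⟩
  · have e : (y₁ * (v * n) + y₂ * (u * m)) ^ 2 + (a₁ * (v * n) + a₂ * (u * m)) ^ 2 - c =
        (y₁ ^ 2 + a₁ ^ 2 - c) + m * (u * ((y₂ - y₁) * (2 * y₁ + u * m * (y₂ - y₁)) +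
          (a₂ - a₁) * (2 * a₁ + u * m * (a₂ - a₁)))) := by
      have : v * n = 1 - u * m := by linarith
      rw [this]; ring
    rw [e]
    exact h₁.add (dvd_mul_right _ _)
  · have e : (y₁ * (v * n) + y₂ * (u * m)) ^ 2 + (a₁ * (v * n) + a₂ * (u * m)) ^ 2 - c =
        (y₂ ^ 2 + a₂ ^ 2 - c) + n * (v * ((y₁ - y₂) * (2 * y₂ + v * n * (y₁ - y₂)) +
          (a₁ - a₂) * (2 * a₂ + v * n * (a₁ - a₂)))) := by
      have : u * m = 1 - v * n := by linarith
      rw [this]; ring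
    rw [e]
    exact h₂.add (dvd_mul_right _ _)

lemma exists_prime_dvd_sq_add_sq_sub {p : ℕ} (hp : p.Prime) (c : ℤ) :
    ∃ y a : ℤ, (p : ℤ) ∣ y ^ 2 + a ^ 2 - c := by
  have := Fact.mk hp
  obtain ⟨y, a, h⟩ := ZMod.sq_add_sq p (c : ZMod p)
  refine ⟨y.val, a.val, ?_⟩
  rw [← ZMod.intCast_zmod_eq_zero_iff_dvd]
  push_cast
  rw [ZMod.natCast_zmod_val, ZMod.natCast_zmod_val, h, sub_self]

/-- Sums of two squares modulo `8` are `0, 1, 2, 4, 5`, and `n - 1` falls in one of these classes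
exactly when `4 ∤ n` and `n ≢ 7 mod 8`. -/
lemma exists_eight_dvd_sq_add_sq_sub {n : ℕ} (h4 : ¬ 4 ∣ n) (h7 : ¬ n ≡ 7 [MOD 8]) :
    ∃ y a : ℤ, (8 : ℤ) ∣ y ^ 2 + a ^ 2 - (n - 1) := by
  have h7' : n % 8 ≠ 7 := h7
  have h : n % 8 = 1 ∨ n % 8 = 2 ∨ n % 8 = 3 ∨ n % 8 = 5 ∨ n % 8 = 6 := by omega
  rcases h with h | h | h | h | h
  · exact ⟨0, 0, by omega⟩
  · exact ⟨1, 0, by omega⟩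
  · exact ⟨1, 1, by omega⟩
  · exact ⟨2, 0, by omega⟩
  · exact ⟨2, 1, by omega⟩

/-- A modulus divisible by all primes up to `P` modulo which admissible numbers are
sums of three squares with one of them equal to `1`. -/
lemma exists_modulus (P : ℕ) : ∃ w : ℕ, 0 < w ∧ 2 ∣ w ∧ (∀ p, p.Prime → p ≤ P → p ∣ w) ∧
    ∀ n : ℕ, ¬ 4 ∣ n → ¬ n ≡ 7 [MOD 8] → ∃ y a : ℤ, (0 ≤ y ∧ y < 2 * w) ∧ (0 ≤ a ∧ a < 2 * w) ∧
      (4 * w : ℤ) ∣ 1 + y ^ 2 + a ^ 2 - n := by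
  set S := (Finset.Icc 1 P).filter (fun p => p.Prime ∧ p ≠ 2)
  have hS : ∀ p ∈ S, p.Prime ∧ p ≠ 2 := fun p hp => (Finset.mem_filter.1 hp).2
  have key : ∀ T ⊆ S, ∀ n : ℕ, ¬ 4 ∣ n → ¬ n ≡ 7 [MOD 8] →
      ∃ y a : ℤ, ((∏ p ∈ T, p : ℕ) : ℤ) * 8 ∣ y ^ 2 + a ^ 2 - (n - 1) := by
    intro T
    induction T using Finset.induction_on with
    | empty =>
      intro _ n h4 h7
      simpa using exists_eight_dvd_sq_add_sq_sub h4 h7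
    | insert p T hpT ih =>
      intro hT n h4 h7
      have hp := hS p (hT (Finset.mem_insert_self _ _))
      rw [Finset.prod_insert hpT]
      push_cast
      rw [mul_assoc]
      have ih' := ih (fun q hq => hT (Finset.mem_insert_of_mem hq)) n h4 h7
      push_cast at ih'
      refine exists_dvd_sq_add_sq_sub_mul ?_ (exists_prime_dvd_sq_add_sq_sub hp.1 _) ih'
      refine IsCoprime.mul_right ?_ ?_
      · refine IsCoprime.prod_right fun q hq => ?_
        have hq' := hS q (hT (Finset.mem_insert_of_mem hq))
        exact Nat.isCoprime_iff_coprime.2 ((Nat.coprime_primes hp.1 hq'.1).2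
          fun h => hpT (h ▸ hq))
      · have : IsCoprime (p : ℤ) ((2 : ℕ) : ℤ) :=
          Nat.isCoprime_iff_coprime.2 ((Nat.coprime_primes hp.1 Nat.prime_two).2 hp.2)
        have h8 : (8 : ℤ) = ((2 : ℕ) : ℤ) ^ 3 := by norm_num
        rw [h8]
        exact this.pow_right
  have hpos : 0 < ∏ p ∈ S, p := Finset.prod_pos fun p hp => (hS p hp).1.pos
  -- With this `w`, `4w` is `8` times the product of the odd primes up to `P`, the modulus treated
  -- in `key`.
  refine ⟨2 * ∏ p ∈ S, p, by positivity, dvd_mul_right _ _, ?_, ?_⟩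
  · intro p hp hpP
    by_cases h2 : p = 2
    · exact h2 ▸ dvd_mul_right _ _
    · exact (Finset.dvd_prod_of_mem (fun p => p) (Finset.mem_filter.2
        ⟨Finset.mem_Icc.2 ⟨hp.one_lt.le, hpP⟩, hp, h2⟩)).mul_left _
  · intro n h4 h7
    obtain ⟨y, a, h⟩ := key S (Finset.Subset.refl _) n h4 h7
    set w := 2 * ∏ p ∈ S, p with hw
    have hwz : (0 : ℤ) < 2 * w := by
      have : 0 < w := by positivity
      exact_mod_cast Nat.mul_pos two_pos this
    -- A square modulo `4w` depends only on its root modulo `2w`, so the roots may be reduced to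
    -- `[0, 2w)`.
    have hsq : ∀ t : ℤ, (4 * w : ℤ) ∣ (t % (2 * w)) ^ 2 - t ^ 2 := by
      intro t
      have h1 : t % (2 * w) = t - 2 * w * (t / (2 * w)) := by
        have := Int.emod_add_mul_ediv t (2 * w); linarith
      rw [h1]
      exact ⟨(t / (2 * w)) * (w * (t / (2 * w)) - t), by ring⟩
    refine ⟨y % (2 * w), a % (2 * w), ⟨Int.emod_nonneg _ hwz.ne', Int.emod_lt_of_pos _ hwz⟩,
      ⟨Int.emod_nonneg _ hwz.ne', Int.emod_lt_of_pos _ hwz⟩, ?_⟩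
    have h' : (4 * w : ℤ) ∣ y ^ 2 + a ^ 2 - (n - 1) := by
      have : (4 * w : ℤ) = ((∏ p ∈ S, p : ℕ) : ℤ) * 8 := by rw [hw]; push_cast; ring
      rw [this]; exact h
    have := ((hsq y).add (hsq a)).add h'
    have e : 1 + (y % (2 * w)) ^ 2 + (a % (2 * w)) ^ 2 - (n : ℤ) = (y % (2 * w)) ^ 2 - y ^ 2 +
        ((a % (2 * w)) ^ 2 - a ^ 2) + (y ^ 2 + a ^ 2 - (n - 1)) := by ring
    rw [e]
    exact this

/-! ### Exceptional numbers in one block -/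

/-- Numbers that are sums of three squares, one of them nonzero with root at most `B`. -/
def HasSmallRoot (B : ℝ) (n : ℕ) : Prop :=
  ∃ x y a : ℤ, 0 < a ∧ (a : ℝ) ≤ B ∧ x ^ 2 + y ^ 2 + a ^ 2 = n

open Classical in
/-- The numbers in a block and in a fixed residue class having no representation with a small
root. -/
lemma card_class_le {w k Q A : ℕ} (hw : 0 < w) (hw2 : 2 ∣ w) (hk : 0 < k) (hQ : 0 < Q)
    (hA0 : 0 < A) {y₀ a₀ : ℤ} {M : ℝ} (hy₀ : 0 ≤ y₀) (hy₀' : y₀ < 2 * w) (ha₀ : 0 ≤ a₀)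
    (ha₀' : a₀ < 2 * w) (hM0 : 0 < M) (hM : ((equalPairs w k Q A y₀ a₀).card : ℝ) ≤ M) :
    (((Finset.Ico ((2 * w * k ^ 2 * Q) ^ 2) ((2 * w * (k ^ 2 + k) * Q) ^ 2)).filter
      (fun n : ℕ => (4 * w : ℤ) ∣ 1 + y₀ ^ 2 + a₀ ^ 2 - n ∧
        ¬ HasSmallRoot (2 * w * (A + 1)) n)).card : ℝ) ≤
      w * (Q ^ 2 * (2 * k ^ 3 + k ^ 2 + 4) + (A + 1) ^ 2) + 1 - (k * Q ^ 2 * A) ^ 2 / M := by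
  set bad := (Finset.Ico ((2 * w * k ^ 2 * Q) ^ 2) ((2 * w * (k ^ 2 + k) * Q) ^ 2)).filter
      (fun n : ℕ => (4 * w : ℤ) ∣ 1 + y₀ ^ 2 + a₀ ^ 2 - n ∧
        ¬ HasSmallRoot (2 * w * (A + 1)) n)
  set G := (box k Q A).image (boxValue w y₀ a₀)
  set badz : Finset ℤ := bad.image (fun n : ℕ => (n : ℤ))
  have hwz : (0 : ℤ) < w := by exact_mod_cast hw
  have hbadz : badz.card = bad.card := Finset.card_image_of_injective _ Nat.cast_injective
  have hG : (k * Q ^ 2 * A) ^ 2 / M ≤ (G.card : ℝ) := by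
    rw [div_le_iff₀ hM0]
    have h1 := sq_card_le_card_image_mul (box k Q A) (boxValue w y₀ a₀)
    rw [card_box] at h1
    have h2 : ((k * Q * (Q * A) : ℕ) : ℝ) ^ 2 ≤ G.card * (equalPairs w k Q A y₀ a₀).card := by
      exact_mod_cast h1
    calc ((k * Q ^ 2 * A) ^ 2 : ℝ) = ((k * Q * (Q * A) : ℕ) : ℝ) ^ 2 := by push_cast; ring
      _ ≤ _ := h2
      _ ≤ _ := by gcongr
  set lo : ℤ := (2 * w * k ^ 2 * Q) ^ 2 with hlo
  -- Values may overshoot the block by the sizes of the second and third squares. The resulting loss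
  -- is small relative to `2k³`, as `k` is large.
  set hi : ℤ := (2 * w * (k ^ 2 + k) * Q) ^ 2 + (4 * w * Q) ^ 2 + (2 * w * (A + 1)) ^ 2 with hhi
  have hrangeG : ∀ v ∈ G, lo ≤ v ∧ v ≤ hi ∧ (4 * w : ℤ) ∣ v - (1 + y₀ ^ 2 + a₀ ^ 2) ∧
      ∃ x y a : ℤ, 0 < a ∧ a ≤ 2 * w * (A + 1) ∧ x ^ 2 + y ^ 2 + a ^ 2 = v := by
    intro v hv
    obtain ⟨⟨x, y, a⟩, hp, rfl⟩ := Finset.mem_image.1 hv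
    obtain ⟨⟨a1, a2⟩, ⟨a3, a4⟩, a5, a6⟩ := mem_box.1 hp
    have b0 : 0 ≤ 2 * (w : ℤ) * k ^ 2 * Q := by positivity
    have b1 : 2 * (w : ℤ) * k ^ 2 * Q ≤ 1 + 2 * w * x := by
      have := mul_le_mul_of_nonneg_left a1 hwz.le
      linarith
    have b2 : 1 + 2 * w * x ≤ 2 * (w : ℤ) * (k ^ 2 + k) * Q := by
      have : (w : ℤ) * x ≤ w * ((k ^ 2 + k) * Q - 1) :=
        mul_le_mul_of_nonneg_left (by linarith) hwz.le
      linarith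
    have b3 : 0 ≤ y₀ + 2 * w * y := by
      have : 0 ≤ (w : ℤ) * y := mul_nonneg hwz.le (by omega)
      linarith
    have b4 : y₀ + 2 * w * y ≤ 4 * w * Q := by
      have : (w : ℤ) * y ≤ w * (2 * Q - 1) := mul_le_mul_of_nonneg_left (by omega) hwz.le
      linarith
    have b5 : 0 < a₀ + 2 * w * a := by
      have : 0 < (w : ℤ) * a := mul_pos hwz (by omega)
      linarith
    have b6 : a₀ + 2 * w * a ≤ 2 * w * (A + 1) := by
      have : (w : ℤ) * a ≤ w * A := mul_le_mul_of_nonneg_left (by omega) hwz.le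
      linarith
    refine ⟨?_, ?_, ?_, _, _, _, b5, b6, rfl⟩
    · have := pow_le_pow_left₀ b0 b1 2
      simp only [boxValue]
      have := sq_nonneg (y₀ + 2 * w * y)
      have := sq_nonneg (a₀ + 2 * w * a)
      linarith
    · have := pow_le_pow_left₀ (b0.trans b1) b2 2
      have := pow_le_pow_left₀ b3 b4 2
      have := pow_le_pow_left₀ b5.le b6 2
      simp only [boxValue]
      linarith
    · obtain ⟨c, hc⟩ := hw2
      simp only [boxValue]
      rw [hc]
      push_cast
      exact ⟨x + 2 * c * x ^ 2 + y₀ * y + 2 * c * y ^ 2 + a₀ * a + 2 * c * a ^ 2, by ring⟩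
  have hrangeB : ∀ v ∈ badz, lo ≤ v ∧ v ≤ hi ∧ (4 * w : ℤ) ∣ v - (1 + y₀ ^ 2 + a₀ ^ 2) ∧
      v ∉ G := by
    intro v hv
    obtain ⟨n, hn, rfl⟩ := Finset.mem_image.1 hv
    obtain ⟨hn, h1, h2⟩ := Finset.mem_filter.1 hn
    obtain ⟨h3, h4⟩ := Finset.mem_Ico.1 hn
    refine ⟨by rw [hlo]; exact_mod_cast h3, ?_, ?_, ?_⟩
    · have : (n : ℤ) < (2 * w * (k ^ 2 + k) * Q) ^ 2 := by exact_mod_cast h4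
      have := sq_nonneg (4 * w * Q : ℤ)
      have := sq_nonneg (2 * w * (A + 1) : ℤ)
      linarith
    · rw [← dvd_neg, neg_sub]; exact h1
    · intro hG
      obtain ⟨-, -, -, x, y, a, ha, ha', he⟩ := hrangeG _ hG
      exact h2 ⟨x, y, a, ha, by exact_mod_cast ha', he⟩
  have hdisj : Disjoint badz G := Finset.disjoint_left.2 fun v hv => (hrangeB v hv).2.2.2
  have hall : ∀ v ∈ badz ∪ G, lo ≤ v ∧ v ≤ hi ∧ (4 * w : ℤ) ∣ v - (1 + y₀ ^ 2 + a₀ ^ 2) := by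
    intro v hv
    rcases Finset.mem_union.1 hv with h | h
    · exact ⟨(hrangeB v h).1, (hrangeB v h).2.1, (hrangeB v h).2.2.1⟩
    · exact ⟨(hrangeG v h).1, (hrangeG v h).2.1, (hrangeG v h).2.2.1⟩
  -- Exceptional numbers and represented values are disjoint subsets of one class modulo `4w` in
  -- `[lo, hi]`, so their counts add up to at most the number of places available.
  have hcard := card_le_of_pairwise_dvd_sub (badz ∪ G) (4 * w) (by positivity)
    (4 * w * (w * (Q ^ 2 * (2 * k ^ 3 + k ^ 2 + 4) + (A + 1) ^ 2))) (by positivity) ?_ ?_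
  · rw [Finset.card_union_of_disjoint hdisj, hbadz] at hcard
    have hwr : (0 : ℝ) < w := by exact_mod_cast hw
    push_cast at hcard
    rw [mul_div_cancel_left₀ _ (by positivity)] at hcard
    linarith
  · intro v hv u hu
    have := dvd_sub (hall v hv).2.2 (hall u hu).2.2
    rwa [sub_sub_sub_cancel_right] at this
  · intro v hv u hu
    have h1 := (hall v hv).2.1
    have h2 := (hall u hu).1
    have h3 : v - u ≤ 4 * w * (w * (Q ^ 2 * (2 * k ^ 3 + k ^ 2 + 4) + (A + 1) ^ 2)) := by
      have : hi - lo = 4 * w * (w * (Q ^ 2 * (2 * k ^ 3 + k ^ 2 + 4) + (A + 1) ^ 2)) := by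
        rw [hhi, hlo]; ring
      linarith
    exact_mod_cast h3

/-- The choice `A = ⌊log Q · (log Q)^(ε/2)⌋` makes `log Q / A` tend to `0`, while half of the
exponent `ε` remains to absorb the factor `4w`. Any fixed power of `A` is negligible against `Q`. -/
lemma eventually_exists_length {ε η : ℝ} (hε : 0 < ε) (hη : 0 < η) {k w : ℕ} (hk : 0 < k)
    (hw : 0 < w) :
    ∀ᶠ Q : ℕ in atTop, ∃ A : ℕ, 0 < A ∧ 2 * w * (A + 1) ^ 2 ≤ Q ∧
      (2 * w * (A + 1) : ℝ) ≤ Real.log Q ^ (1 + ε) ∧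
      (k + 8 * k * (1 + Real.log Q) +
        (1 + 10 / k) * (1 + Real.log (2 * w * (A + 1))) ^ 2) / A +
      6 * k * (2 * w * (A + 1) ^ 2 + 1) ^ 2 * (1 + Real.log Q) / Q ≤ η := by
  have hkr : (1 : ℝ) ≤ k := by exact_mod_cast hk
  have hwr : (1 : ℝ) ≤ w := by exact_mod_cast hw
  -- The second error term is at most `48kB⁵/Q` with `B = (log Q)^(1+ε)`; `B⁵ ≤ cQ` makes this at
  -- most `η/2`.
  set c : ℝ := min 1 (η / (96 * k)) with hc
  have hc0 : 0 < c := lt_min one_pos (by positivity)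
  have hcast : Tendsto (fun Q : ℕ => (Q : ℝ)) atTop atTop := tendsto_natCast_atTop_atTop
  have hL : Tendsto (fun Q : ℕ => Real.log Q) atTop atTop := Real.tendsto_log_atTop.comp hcast
  have f1 : ∀ᶠ Q : ℕ in atTop, 1 ≤ Real.log Q := hL.eventually_ge_atTop 1
  -- The bound `4w` gives `2w(A+1) ≤ (log Q)^(1+ε)`, `2` controls the rounding in `A`, and `112k/η`
  -- makes the first error, at most `28k log Q / A`, no larger than `η/2`.
  have f2 : ∀ᶠ Q : ℕ in atTop, max (4 * w : ℝ) (max 2 (112 * k / η)) ≤ Real.log Q ^ (ε / 2) :=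
    ((tendsto_rpow_atTop (half_pos hε)).comp hL).eventually_ge_atTop _
  have f3 : ∀ᶠ Q : ℕ in atTop, 1 + (1 + ε) * Real.log (Real.log Q) ≤ Real.log Q ^ (1 / 2 : ℝ) := by
    have h1 : (fun x : ℝ => 1 + (1 + ε) * Real.log x) =o[atTop] fun x => x ^ (1 / 2 : ℝ) := by
      refine Asymptotics.IsLittleO.add ?_ ((isLittleO_log_rpow_atTop (by norm_num)).const_mul_left _)
      exact Asymptotics.isLittleO_const_left.2 (Or.inr
        (tendsto_norm_atTop_atTop.comp (tendsto_rpow_atTop (by norm_num))))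
    have h2 := (h1.bound one_pos).and (eventually_ge_atTop (0 : ℝ))
    filter_upwards [hL.eventually h2] with Q hQ
    have h3 := hQ.1
    rw [one_mul, Real.norm_eq_abs, Real.norm_eq_abs,
      abs_of_nonneg (Real.rpow_nonneg hQ.2 _)] at h3
    exact (le_abs_self _).trans h3
  have f4 : ∀ᶠ Q : ℕ in atTop, Real.log Q ^ ((1 + ε) * 5) ≤ c * Q := by
    have h1 : (fun x : ℝ => Real.log x ^ ((1 + ε) * 5)) =o[atTop] fun x => x ^ (1 : ℝ) :=
      isLittleO_log_rpow_rpow_atTop _ one_pos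
    filter_upwards [hcast.eventually (h1.bound hc0)] with Q hQ
    rw [Real.rpow_one, Real.norm_eq_abs, Real.norm_eq_abs,
      abs_of_nonneg (Nat.cast_nonneg Q : (0 : ℝ) ≤ Q)] at hQ
    exact (le_abs_self _).trans hQ
  filter_upwards [f1, f2, f3, f4, eventually_gt_atTop 0] with Q g1 g2 g3 g4 hQ
  set x := Real.log Q
  set R := x ^ (ε / 2) with hR
  have hx0 : 0 < x := by linarith
  obtain ⟨r1, r2, r3⟩ : 4 * w ≤ R ∧ 2 ≤ R ∧ 112 * k / η ≤ R :=
    ⟨(le_max_left _ _).trans g2, (le_max_left _ _).trans ((le_max_right _ _).trans g2),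
      (le_max_right _ _).trans ((le_max_right _ _).trans g2)⟩
  have hB : x ^ (1 + ε) = x * R ^ 2 := by
    rw [hR, Real.rpow_add hx0, Real.rpow_one, ← Real.rpow_natCast, ← Real.rpow_mul hx0.le]
    congr 2
    push_cast
    ring
  have hB5 : x ^ ((1 + ε) * 5) = (x * R ^ 2) ^ 5 := by
    rw [Real.rpow_mul hx0.le, hB]
    exact Real.rpow_ofNat _ 5
  set B := x * R ^ 2 with hBdef
  have hQr : (0 : ℝ) < Q := by exact_mod_cast hQ
  have hxR : 2 ≤ x * R := by nlinarith
  have hxB : x ≤ B := by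
    have : (1 : ℝ) ≤ R ^ 2 := by nlinarith
    rw [hBdef]
    exact le_mul_of_one_le_right hx0.le this
  have hB1 : 1 ≤ B := g1.trans hxB
  set A := ⌊x * R⌋₊
  have hA1 : (A : ℝ) ≤ x * R := Nat.floor_le (by positivity)
  have hA2 : x * R / 2 ≤ A := by
    have := Nat.lt_floor_add_one (x * R)
    linarith
  have hApos : (0 : ℝ) < A := by linarith
  have hAB : 2 * w * ((A : ℝ) + 1) ≤ B := by
    calc 2 * w * ((A : ℝ) + 1) ≤ 2 * w * (x * R + x * R) := by gcongr; linarith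
      _ = (4 * w) * (x * R) := by ring
      _ ≤ R * (x * R) := by gcongr
      _ = B := by rw [hBdef]; ring
  have hAB2 : 2 * w * ((A : ℝ) + 1) ^ 2 ≤ B ^ 2 := by
    have h1 : (A : ℝ) + 1 ≤ B := by
      refine le_trans ?_ hAB
      exact le_mul_of_one_le_left (by positivity) (by linarith)
    calc 2 * w * ((A : ℝ) + 1) ^ 2 = (2 * w * ((A : ℝ) + 1)) * (A + 1) := by ring
      _ ≤ B * B := by gcongr
      _ = B ^ 2 := by ring
  rw [hB5] at g4
  have hBQ : B ^ 5 ≤ Q := g4.trans (mul_le_of_le_one_left hQr.le (min_le_left _ _))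
  have hBη : B ^ 5 ≤ η / (96 * k) * Q :=
    g4.trans (mul_le_mul_of_nonneg_right (min_le_right _ _) hQr.le)
  refine ⟨A, by exact_mod_cast hApos, ?_, by rw [hB]; exact hAB, ?_⟩
  · have h1 : B ^ 2 ≤ B ^ 5 := pow_le_pow_right₀ hB1 (by norm_num)
    have h2 : 2 * w * ((A : ℝ) + 1) ^ 2 ≤ Q := by linarith
    exact_mod_cast h2
  · have hlog : (1 + Real.log (2 * w * (A + 1))) ^ 2 ≤ x := by
      have h1 : Real.log (2 * w * (A + 1)) ≤ (1 + ε) * Real.log x := by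
        rw [← Real.log_rpow hx0, hB]
        exact Real.log_le_log (by positivity) hAB
      have h2 : 0 ≤ Real.log (2 * w * (A + 1)) := by
        apply Real.log_nonneg
        nlinarith
      calc (1 + Real.log (2 * w * (A + 1))) ^ 2 ≤ (x ^ (1 / 2 : ℝ)) ^ 2 := by
            apply pow_le_pow_left₀ (by linarith)
            linarith
        _ = x := by
            rw [← Real.rpow_natCast, ← Real.rpow_mul hx0.le]
            norm_num
    have e1 : (k + 8 * k * (1 + x) + (1 + 10 / k) * (1 + Real.log (2 * w * (A + 1))) ^ 2) / A ≤
        η / 2 := by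
      have h10 : (10 : ℝ) / k ≤ 10 := div_le_self (by norm_num) hkr
      have h1 : k + 8 * k * (1 + x) + (1 + 10 / k) * (1 + Real.log (2 * w * (A + 1))) ^ 2 ≤
          28 * k * x := by
        have h2 : (1 + 10 / k) * (1 + Real.log (2 * w * (A + 1))) ^ 2 ≤ 11 * x := by
          gcongr
          linarith
        nlinarith [mul_le_mul_of_nonneg_left g1 (by linarith : (0 : ℝ) ≤ k),
          mul_le_mul_of_nonneg_right hkr hx0.le]
      rw [div_le_iff₀ hApos]
      refine h1.trans ?_
      have h3 : 112 * k ≤ R * η := (div_le_iff₀ hη).1 r3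
      have h4 : η / 2 * (x * R / 2) ≤ η / 2 * A := by gcongr
      have h5 := mul_le_mul_of_nonneg_left h3 hx0.le
      linarith
    have e2 : 6 * k * (2 * w * (A + 1) ^ 2 + 1) ^ 2 * (1 + x) / Q ≤ η / 2 := by
      rw [div_le_iff₀ hQr]
      have h1 : (2 * w * ((A : ℝ) + 1) ^ 2 + 1) ≤ 2 * B ^ 2 := by
        have := one_le_pow₀ hB1 (n := 2)
        linarith
      calc 6 * k * (2 * w * ((A : ℝ) + 1) ^ 2 + 1) ^ 2 * (1 + x) ≤
          6 * k * (2 * B ^ 2) ^ 2 * (B + B) := by gcongr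
        _ = 48 * k * B ^ 5 := by ring
        _ ≤ 48 * k * (η / (96 * k) * Q) := by gcongr
        _ = η / 2 * Q := by field_simp; ring
    linarith

/-- The leading terms `2k³wQ²` of available places and guaranteed values cancel. What remains is of
relative size `δ` and `1/k`, and is multiplied by the `4w` classes. -/
lemma four_mul_defect_le {k w Q A δ θ κ M : ℝ} (hδ0 : 0 < δ) (hδθ : δ ≤ θ / 128)
    (hk : 10 ≤ k) (hkδ : 10 ≤ k * δ) (hw : 1 ≤ w) (hQ : 1 ≤ Q) (hA0 : 0 < A)
    (hA : 2 * w * (A + 1) ^ 2 ≤ Q) (hκ1 : 1 ≤ κ) (hκ2 : κ ≤ 1 + 7 * δ)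
    (hM : M = A ^ 2 * Q ^ 2 / (2 * k * w) * (κ + δ)) :
    4 * w * (w * (Q ^ 2 * (2 * k ^ 3 + k ^ 2 + 4) + (A + 1) ^ 2) + 1 - (k * Q ^ 2 * A) ^ 2 / M) ≤
      θ * k ^ 3 * w ^ 2 * Q ^ 2 := by
  have hk0 : 0 < k := by linarith
  have hw0 : 0 < w := by linarith
  have hQ0 : 0 < Q := by linarith
  have hκδ : 0 < κ + δ := by linarith
  have e : (k * Q ^ 2 * A) ^ 2 / M = 2 * k ^ 3 * w * Q ^ 2 * (1 / (κ + δ)) := by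
    rw [hM]; field_simp
  have h1 : 1 - 8 * δ ≤ 1 / (κ + δ) := by
    rw [le_div_iff₀ hκδ]
    have h2 : κ + δ ≤ 1 + 8 * δ := by linarith
    have h3 : 1 ≤ κ + δ := by linarith
    nlinarith
  have h2 := mul_le_mul_of_nonneg_left h1 (by positivity : (0 : ℝ) ≤ 2 * k ^ 3 * w * Q ^ 2)
  have h3 : (A + 1) ^ 2 ≤ Q ^ 2 := by
    have h5 : 1 * (A + 1) ^ 2 ≤ 2 * w * (A + 1) ^ 2 :=
      mul_le_mul_of_nonneg_right (by linarith) (by positivity)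
    have h6 : Q ≤ Q ^ 2 := le_self_pow₀ hQ (by norm_num)
    linarith
  have h7 : 1 ≤ w * Q ^ 2 := one_le_mul_of_one_le_of_one_le hw (one_le_pow₀ hQ)
  have h8 : w * (Q ^ 2 * (2 * k ^ 3 + k ^ 2 + 4) + (A + 1) ^ 2) + 1 - (k * Q ^ 2 * A) ^ 2 / M ≤
      w * Q ^ 2 * (16 * k ^ 3 * δ + k ^ 2 + 6) := by
    rw [e]
    have h9 := mul_le_mul_of_nonneg_left h3 hw0.le
    linarith
  have h10 : 16 * k ^ 3 * δ + k ^ 2 + 6 ≤ θ / 4 * k ^ 3 := by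
    have a1 : 16 * k ^ 3 * δ ≤ 16 * k ^ 3 * (θ / 128) :=
      mul_le_mul_of_nonneg_left hδθ (by positivity)
    have a0 : k * δ ≤ k * (θ / 128) := mul_le_mul_of_nonneg_left hδθ hk0.le
    have a2 : 1280 ≤ k * θ := by linarith
    have a3 := mul_le_mul_of_nonneg_left a2 (by positivity : (0 : ℝ) ≤ k ^ 2)
    have a4 : 1 ≤ k ^ 2 := one_le_pow₀ (by linarith)
    linarith
  have h11 := mul_le_mul_of_nonneg_left h10 (by positivity : (0 : ℝ) ≤ 4 * w * (w * Q ^ 2))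
  have h12 := mul_le_mul_of_nonneg_left h8 (by positivity : (0 : ℝ) ≤ 4 * w)
  linarith

-- Parameters are chosen in the order `δ`, `k`, the prime bound `P`, `w`, and finally `A` for each
-- large `Q`. The block is split into classes modulo `4w`, each handled by `card_class_le`.
open Classical in
lemma exists_block {ε θ : ℝ} (hε : 0 < ε) (hθ : 0 < θ) :
    ∃ k w : ℕ, 2 ≤ k ∧ 0 < w ∧ ∀ᶠ Q : ℕ in atTop,
      (((Finset.Ico ((2 * w * k ^ 2 * Q) ^ 2) ((2 * w * (k ^ 2 + k) * Q) ^ 2)).filter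
        (fun n : ℕ => (¬ 4 ∣ n ∧ ¬ n ≡ 7 [MOD 8]) ∧
          ¬ HasSmallRoot (Real.log n ^ (1 + ε)) n)).card : ℝ) ≤ θ * k ^ 3 * w ^ 2 * Q ^ 2 := by
  set δ : ℝ := min 1 (θ / 128) with hδ
  have hδ0 : 0 < δ := lt_min one_pos (by positivity)
  have hδ1 : δ ≤ 1 := min_le_left _ _
  have hδθ : δ ≤ θ / 128 := min_le_right _ _
  obtain ⟨k, hk⟩ := exists_nat_ge (10 / δ)
  have hkδ : 10 ≤ k * δ := (div_le_iff₀ hδ0).1 hk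
  have hk10 : (10 : ℝ) ≤ k := by nlinarith
  have hk10' : 10 ≤ k := by exact_mod_cast hk10
  have hkpos : 0 < k := by omega
  obtain ⟨P, hP⟩ := exists_sum_coprimeIcc_le hδ0
  obtain ⟨w, hw, hw2, hwP, hres⟩ := exists_modulus P
  have hz := hP w hwP
  have hwr : (1 : ℝ) ≤ w := by exact_mod_cast hw
  refine ⟨k, w, by omega, hw, ?_⟩
  filter_upwards [eventually_exists_length hε
    (by positivity : 0 < δ / (2 * k * w : ℝ)) hkpos hw, eventually_gt_atTop 0] with Q hA hQ
  obtain ⟨A, hA0, hA1, hA2, hA3⟩ := hA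
  have hQr : (1 : ℝ) ≤ Q := by exact_mod_cast hQ
  have hAr : (0 : ℝ) < A := by exact_mod_cast hA0
  set κ : ℝ := (1 + 10 / k) * (1 + δ) ^ 2 with hκ
  have hκ1 : 1 ≤ κ := by
    have h1 : (0 : ℝ) ≤ 10 / k := by positivity
    have h2 : 1 ≤ (1 + δ) ^ 2 := one_le_pow₀ (by linarith)
    rw [hκ]
    exact one_le_mul_of_one_le_of_one_le (by linarith) h2
  have hκ2 : κ ≤ 1 + 7 * δ := by
    have h1 : (10 : ℝ) / k ≤ δ := by
      rw [div_le_iff₀ (by linarith)]; linarith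
    have h2 : (1 + δ) ^ 2 ≤ 1 + 3 * δ := by nlinarith
    calc κ ≤ (1 + δ) * (1 + 3 * δ) := by rw [hκ]; gcongr
      _ ≤ _ := by nlinarith
  set M : ℝ := A ^ 2 * Q ^ 2 / (2 * k * w) * (κ + δ) with hMdef
  have hM0 : 0 < M := by positivity
  set β : ℝ := w * (Q ^ 2 * (2 * k ^ 3 + k ^ 2 + 4) + (A + 1) ^ 2) + 1 - (k * Q ^ 2 * A) ^ 2 / M
    with hβ
  have hA4 : 2 * w * ((A : ℝ) + 1) ^ 2 ≤ Q := by exact_mod_cast hA1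
  have hβ1 : 4 * w * β ≤ θ * k ^ 3 * w ^ 2 * Q ^ 2 :=
    four_mul_defect_le hδ0 hδθ hk10 hkδ hwr hQr hAr hA4 hκ1 hκ2 hMdef
  set S := (Finset.Ico ((2 * w * k ^ 2 * Q) ^ 2) ((2 * w * (k ^ 2 + k) * Q) ^ 2)).filter
        (fun n : ℕ => (¬ 4 ∣ n ∧ ¬ n ≡ 7 [MOD 8]) ∧ ¬ HasSmallRoot (Real.log n ^ (1 + ε)) n)
  have hsmall : ∀ n ∈ S, ¬ HasSmallRoot (2 * w * (A + 1)) n := by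
    intro n hn
    obtain ⟨hn, -, h⟩ := Finset.mem_filter.1 hn
    rintro ⟨x, y, a, h1, h2, h3⟩
    refine h ⟨x, y, a, h1, h2.trans (hA2.trans ?_), h3⟩
    have hQn : Q ≤ n := by
      refine le_trans ?_ (Finset.mem_Ico.1 hn).1
      have : Q ≤ 2 * w * k ^ 2 * Q := Nat.le_mul_of_pos_left _ (by positivity)
      exact this.trans (Nat.le_self_pow (by norm_num) _)
    have hQn' : (Q : ℝ) ≤ n := by exact_mod_cast hQn
    exact Real.rpow_le_rpow (Real.log_nonneg hQr) (Real.log_le_log (by linarith) hQn')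
      (by linarith)
  -- The maximum with `0` covers empty classes, since `β` has not been shown to be nonnegative.
  have hfib : ∀ r ∈ Finset.range (4 * w), ((S.filter (fun n => n % (4 * w) = r)).card : ℝ) ≤
      max β 0 := by
    intro r _
    rcases (S.filter (fun n => n % (4 * w) = r)).eq_empty_or_nonempty with h | ⟨m, hm⟩
    · rw [h, Finset.card_empty, Nat.cast_zero]
      exact le_max_right _ _
    obtain ⟨hm, hmr⟩ := Finset.mem_filter.1 hm
    obtain ⟨-, ⟨hm4, hm7⟩, -⟩ := Finset.mem_filter.1 hm
    -- A single member `m` supplies `y₀` and `a₀`; they serve its whole class, because the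
    -- congruence is modulo `4w`.
    obtain ⟨y₀, a₀, ⟨hy₀, hy₀'⟩, ⟨ha₀, ha₀'⟩, hdvd⟩ := hres m hm4 hm7
    have hN := card_equalPairs_le hw hw2 hkpos hQ hy₀ hy₀' ha₀ ha₀' hA1 hz
    have hNM : ((equalPairs w k Q A y₀ a₀).card : ℝ) ≤ M := by
      refine hN.trans ?_
      have h1 := mul_le_mul_of_nonneg_left hA3 (by positivity : (0 : ℝ) ≤ A ^ 2 * Q ^ 2)
      have e1 : M = A ^ 2 * Q ^ 2 / (2 * k * w) * (1 + 10 / k) * (1 + δ) ^ 2 +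
          A ^ 2 * Q ^ 2 * (δ / (2 * k * w)) := by
        rw [hMdef, hκ]; field_simp
      rw [e1, add_assoc]
      gcongr
      refine le_trans (le_of_eq ?_) h1
      field_simp
    refine le_trans ?_ ((card_class_le hw hw2 hkpos hQ hA0 hy₀ hy₀' ha₀ ha₀' hM0 hNM).trans
      (le_max_left _ _))
    refine Nat.cast_le.2 (Finset.card_le_card fun n hn => ?_)
    obtain ⟨hn, hnr⟩ := Finset.mem_filter.1 hn
    refine Finset.mem_filter.2 ⟨(Finset.mem_filter.1 hn).1, ?_, hsmall n hn⟩
    have h1 : m ≡ n [MOD 4 * w] := hmr.trans hnr.symm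
    have h2 : ((4 * w : ℕ) : ℤ) ∣ n - m := Nat.modEq_iff_dvd.1 h1
    push_cast at h2
    have h3 := dvd_sub hdvd h2
    have e : 1 + y₀ ^ 2 + a₀ ^ 2 - (m : ℤ) - (n - m) = 1 + y₀ ^ 2 + a₀ ^ 2 - n := by ring
    rwa [e] at h3
  rw [Finset.card_eq_sum_card_fiberwise (f := fun n => n % (4 * w)) (t := Finset.range (4 * w)),
    Nat.cast_sum]
  · refine (Finset.sum_le_sum hfib).trans ?_
    rw [Finset.sum_const, nsmul_eq_mul, Finset.card_range]
    rcases le_total β 0 with h | h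
    · rw [max_eq_right h, mul_zero]
      positivity
    · rw [max_eq_left h]
      push_cast
      exact hβ1
  · intro n _
    exact Finset.mem_coe.2 (Finset.mem_range.2 (Nat.mod_lt _ (by omega)))

/-! ### From blocks to all integers up to a bound -/

-- Strong induction on `X`: cover the top of the range by one block starting at `X' < X`. Its
-- exceptional count is at most `θ(X - X')`, so the bounds telescope without loss in `θ`, and `C`
-- covers small `X`.
open Classical in
lemma exists_card_filter_range_le {ε θ : ℝ} (hε : 0 < ε) (hθ : 0 < θ) :
    ∃ C : ℝ, ∀ X : ℕ, (((Finset.range X).filter (fun n : ℕ => (¬ 4 ∣ n ∧ ¬ n ≡ 7 [MOD 8]) ∧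
      ¬ HasSmallRoot (Real.log n ^ (1 + ε)) n)).card : ℝ) ≤ θ * X + C := by
  set bad : ℕ → Prop := fun n => (¬ 4 ∣ n ∧ ¬ n ≡ 7 [MOD 8]) ∧
      ¬ HasSmallRoot (Real.log n ^ (1 + ε)) n with hbad
  obtain ⟨k, w, hk, hw, hQ⟩ := exists_block hε hθ
  obtain ⟨Q₀, hQ₀⟩ := eventually_atTop.1 hQ
  set c := 2 * w * (k ^ 2 + k) with hc
  have hc0 : 0 < c := by positivity
  set C := (c * max Q₀ (16 * k)) ^ 2
  refine ⟨C, fun X => ?_⟩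
  induction X using Nat.strong_induction_on with
  | _ X ih =>
  rcases lt_or_ge X C with hX | hX
  · have h1 : (((Finset.range X).filter bad).card : ℝ) ≤ X := by
      exact_mod_cast (Finset.card_filter_le _ _).trans (Finset.card_range X).le
    have h2 : (X : ℝ) ≤ C := by exact_mod_cast hX.le
    have h3 : 0 ≤ θ * X := by positivity
    linarith
  -- The least `Q` for which the block's right end `(cQ)²` exceeds `X`. The block may extend past
  -- `X`, and `(c(Q-1))² ≤ X` limits the excess.
  · set Q := Nat.sqrt X / c + 1 with hQdef
    have hs : c * max Q₀ (16 * k) ≤ Nat.sqrt X := Nat.le_sqrt'.2 hX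
    have hQm : max Q₀ (16 * k) ≤ Nat.sqrt X / c :=
      (Nat.le_div_iff_mul_le hc0).2 (by rw [mul_comm]; exact hs)
    have hQ1 : Q₀ ≤ Q := by have := le_max_left Q₀ (16 * k); omega
    have hQ2 : 16 * k ≤ Q - 1 := by have := le_max_right Q₀ (16 * k); omega
    have hX1 : X < (c * Q) ^ 2 := by
      refine Nat.sqrt_lt'.1 ?_
      exact Nat.lt_mul_div_succ _ hc0
    have hX2 : (c * (Q - 1)) ^ 2 ≤ X := by
      refine Nat.le_sqrt'.1 ?_
      rw [hQdef, Nat.add_sub_cancel]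
      exact Nat.mul_div_le _ _
    obtain ⟨q, hq⟩ : ∃ q, Q = q + 1 := ⟨_, hQdef⟩
    rw [hq, Nat.add_sub_cancel] at hX2 hQ2
    set X' := (2 * w * k ^ 2 * Q) ^ 2 with hX'
    have hkr : (2 : ℝ) ≤ k := by exact_mod_cast hk
    have hwr : (0 : ℝ) < w := by exact_mod_cast hw
    have hqr : 16 * (k : ℝ) ≤ q := by exact_mod_cast hQ2
    have hX2r : (2 * w * (k ^ 2 + k) * q) ^ 2 ≤ (X : ℝ) := by exact_mod_cast hX2
    have hmain : (X' : ℝ) + k ^ 3 * w ^ 2 * Q ^ 2 ≤ X := by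
      refine le_trans ?_ hX2r
      rw [hX', hq]
      push_cast
      -- After removing the common factor `w²k²`, this says that replacing `q + 1` by `q` costs less
      -- than the spare part of the block. It is here that `q ≥ 16k` is needed.
      have h1 : (4 * k ^ 2 + k) * ((q : ℝ) + 1) ^ 2 ≤ (4 * k ^ 2 + 8 * k + 4) * q ^ 2 := by
        have a1 : 16 * (k : ℝ) * q ≤ q * q := mul_le_mul_of_nonneg_right hqr (by linarith)
        have a2 : (2 * q + 1 : ℝ) * (8 * k) ≤ 3 * q * q := by nlinarith
        have a3 := mul_le_mul_of_nonneg_left a2 (by linarith : (0 : ℝ) ≤ k)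
        have a4 : (4 * k ^ 2 + k : ℝ) * (2 * q + 1) ≤ 8 * k ^ 2 * (2 * q + 1) :=
          mul_le_mul_of_nonneg_right (by nlinarith) (by linarith)
        have a5 : 0 ≤ (k : ℝ) * q * q := by positivity
        nlinarith
      have h2 := mul_le_mul_of_nonneg_left h1 (by positivity : (0 : ℝ) ≤ w ^ 2 * k ^ 2)
      linarith
    have hlt : X' < X := by
      have : (0 : ℝ) < k ^ 3 * w ^ 2 * Q ^ 2 := by
        have : 0 < Q := by omega
        positivity
      have : (X' : ℝ) < X := by linarith
      exact_mod_cast this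
    have h1 := ih X' hlt
    have h2 := hQ₀ Q hQ1
    have h3 : ((Finset.range X).filter bad).card ≤ ((Finset.range X').filter bad).card +
        ((Finset.Ico X' ((c * Q) ^ 2)).filter bad).card := by
      refine le_trans (Finset.card_le_card fun n hn => ?_) (Finset.card_union_le _ _)
      obtain ⟨hn, hb⟩ := Finset.mem_filter.1 hn
      rw [Finset.mem_union, Finset.mem_filter, Finset.mem_filter, Finset.mem_range, Finset.mem_Ico]
      have := Finset.mem_range.1 hn
      rcases lt_or_ge n X' with h | h
      · exact Or.inl ⟨h, hb⟩
      · exact Or.inr ⟨⟨h, this.trans hX1⟩, hb⟩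
    have h4 : (((Finset.range X).filter bad).card : ℝ) ≤ ((Finset.range X').filter bad).card +
        ((Finset.Ico X' ((c * Q) ^ 2)).filter bad).card := by exact_mod_cast h3
    have h5 := mul_le_mul_of_nonneg_left hmain hθ.le
    linarith

/-! ### Return to lattice points -/

/-- Reflection in the third coordinate gives a second solution, distinct because `a > 0`, at
normalised distance `2a n^(-1/2)`. -/
lemma HasSmallRoot.nontrivial_and_minSpacing_le {B : ℝ} {n : ℕ} (hn : 0 < n)
    (h : HasSmallRoot B n) : (normalizedLatticePoints n).Nontrivial ∧
      minSpacing (normalizedLatticePoints n) ≤ 2 * (n : ℝ) ^ (-1 / 2 : ℝ) * B := by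
  obtain ⟨x, y, a, ha, haB, he⟩ := h
  set s : ℝ := (n : ℝ) ^ (-1 / 2 : ℝ)
  have hs : 0 < s := Real.rpow_pos_of_pos (by exact_mod_cast hn) _
  have har : (0 : ℝ) < a := by exact_mod_cast ha
  set p : Fin 3 → ℤ := ![x, y, a]
  set q : Fin 3 → ℤ := ![x, y, -a]
  set P : EuclideanSpace ℝ (Fin 3) := s • WithLp.toLp 2 (fun i => (p i : ℝ))
  set R : EuclideanSpace ℝ (Fin 3) := s • WithLp.toLp 2 (fun i => (q i : ℝ))
  have hP : P ∈ normalizedLatticePoints n := ⟨p, by simpa [p] using he, rfl⟩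
  have hR : R ∈ normalizedLatticePoints n := ⟨q, by simpa [q] using he, rfl⟩
  have hd : dist P R = s * (2 * a) := by
    rw [dist_smul₀, Real.norm_of_nonneg hs.le, EuclideanSpace.dist_eq, Fin.sum_univ_three]
    congr 1
    simp only [p, q, Matrix.cons_val_zero, Matrix.cons_val_one, Matrix.cons_val, dist_self,
      Real.dist_eq, Int.cast_neg]
    rw [sub_neg_eq_add, sq_abs, zero_pow two_ne_zero, zero_add, zero_add,
      Real.sqrt_sq (by positivity), two_mul]
  have hne : P ≠ R := by
    rw [← dist_pos, hd]
    positivity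
  refine ⟨⟨P, hP, R, hR, hne⟩, ?_⟩
  calc minSpacing (normalizedLatticePoints n) ≤ dist P R :=
        Set.infsep_le_dist_of_mem hP hR hne
    _ = 2 * s * a := by rw [hd]; ring
    _ ≤ 2 * s * B := by gcongr

theorem corollary1p4 (ε : ℝ) (hε : 0 < ε) :
    ∃ C : ℝ, 0 < C ∧
      ForAlmostAll (fun n : ℕ => ¬ (4 ∣ n) ∧ ¬ (n ≡ 7 [MOD 8]))
        (fun n : ℕ => (normalizedLatticePoints n).Nontrivial ∧
          minSpacing (normalizedLatticePoints n) ≤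
            C * (n : ℝ) ^ (-1 / 2 : ℝ) * Real.log (n : ℝ) ^ (1 + ε)) := by
  classical
  refine ⟨2, two_pos, ?_⟩
  refine tendsto_order.2 ⟨fun b hb => Eventually.of_forall fun X =>
    lt_of_lt_of_le hb (by positivity), fun b hb => ?_⟩
  -- The range is `X + 1`, so the count is at most `(b/4)(X + 1) + C`; with `X ≥ 1` and `C < bX/4`
  -- this is below `bX`.
  obtain ⟨C, hC⟩ := exists_card_filter_range_le hε (by positivity : 0 < b / 4)
  obtain ⟨N, hN⟩ := exists_nat_gt (C * 4 / b)
  filter_upwards [eventually_ge_atTop N, eventually_ge_atTop 1] with X hX hX1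
  have hXr : (1 : ℝ) ≤ X := by exact_mod_cast hX1
  rw [div_lt_iff₀ (by linarith)]
  have h1 := hC (X + 1)
  rw [← Set.ncard_coe_finset] at h1
  refine lt_of_le_of_lt (Nat.cast_le.2 (Set.ncard_le_ncard ?_ (Finset.finite_toSet _)))
    (lt_of_le_of_lt h1 ?_)
  · rintro n ⟨hn1, hn2, hA, hP⟩
    refine Finset.mem_coe.2 (Finset.mem_filter.2 ⟨Finset.mem_range.2 (by omega), hA, ?_⟩)
    exact fun h => hP (h.nontrivial_and_minSpacing_le hn1)
  · have h2 : C * 4 < X * b := by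
      have h3 : (N : ℝ) ≤ X := by exact_mod_cast hX
      exact (div_lt_iff₀ hb).1 (hN.trans_le h3)
    have h4 : b * 1 ≤ b * X := mul_le_mul_of_nonneg_left hXr hb.le
    push_cast
    linarith
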